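/- **Random-order streaming.** A ground set $\mathcal U$ of $n$ items arrives one item at a time in a uniformly random order. $f:2^{\mathcal U}\to\mathbb R_{\ge 0}$ is monotone and submodular, and a family of feasible subsets of $\mathcal U$ is given. A (randomized) streaming algorithm with memory $M$ knows $n$ and the parameters $k,\varepsilon$ (and $p$) and has $M$ memory cells. Each cell can hold one item and one integer in $\{0,\dots,n\}$. When an item arrives the algorithm may query the value of $f$, and the feasibility, of any set made of stored items and the arriving item, and then it rewrites its memory; items that are not kept are lost. After the last arrival it returns a set of stored items. It achieves ratio $r$ if the returned set $S$ is always feasible and $\mathbb E[f(S)]\ge r\cdot\max\{f(T): T\text{ feasible}\}$, the expectation being over the arrival order and the coins of the algorithm. Below, the algorithms do not depend on $f$ or on the matroids. 1. (Cardinality.) There are absolute constants $C>0$ and $c\in\mathbb N$ such that for all $\varepsilon>0$, all $n$ and all $k\ge C/\varepsilon^2$ there is a streaming algorithm that achieves ratio $1-\frac1e-\varepsilon$ for the constraint $|S|\le k$ with memory at most $C\,\frac{k}{\varepsilon^2}\log^{c}(2+\frac1\varepsilon)=\tilde O(k/\varepsilon^2)$. 2. (Matroid.) There is an absolute constant $C>0$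 such that for all $\varepsilon>0$, $k$ and $n$ there is a streaming algorithm with memory at most $C\,k/\varepsilon$ that achieves ratio $\frac12\left(1-\frac1{e^2}-\varepsilon\right)$ for the constraint that $S$ is independent in a matroid of rank $k$. 3. ($p$-matchoid.) There is an absolute constant $C>0$ such that for all $\varepsilon>0$, $p$, $k$ and $n$ there is a streaming algorithm with memory at most $C\,k/\varepsilon$ that achieves ratio $\frac1{p+1}\left(1-\frac1{e^{p+1}}-\varepsilon\right)$ for every $p$-matchoid constraint whose largest feasible sets have $k$ items. That is, there are matroids $\mathcal M_1,\dots,\mathcal M_q$ on ground sets $\mathcal N_1,\dots,\mathcal N_q\subseteq\mathcal U$ such that every item lies in at most $p$ of the $\mathcal N_i$, and $S$ is feasible if and only if $S\cap\mathcal N_i$ is independent in $\mathcal M_i$ for every $i$. -/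

import Mathlib

noncomputable section

/-- A set function on the subsets of a finite ground set is submodular. -/
def IsSubmodular {α : Type*} [DecidableEq α] (f : Finset α → ℝ) : Prop :=
  ∀ S T : Finset α, f (S ∪ T) + f (S ∩ T) ≤ f S + f T

/-- Objective functions: nonnegative, monotone and submodular. -/
structure IsObjective {α : Type*} [DecidableEq α] (f : Finset α → ℝ) : Prop where
  nonneg : ∀ S, 0 ≤ f S
  monotone : Monotone f
  submodular : IsSubmodular f

/-- The items kept in a set `Q` of places, where `c i` is the item (if any) at place `i`. -/
def collect {ι α : Type*} [DecidableEq α] (c : ι → Option α) (Q : Finset ι) : Finset α :=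
  Q.biUnion fun i => (c i).toFinset

/-- A memory of `M` cells. Each cell has room for at most one item of the stream and for one
integer between `0` and `n`, where `n` is the length of the stream. -/
structure StreamMemory (α : Type) (n M : ℕ) where
  item : Fin M → Option α
  word : Fin M → Fin (n + 1)

/-- All that an algorithm can see when its accessible items lie at the places `ι`: its integers,
which places hold an item, and the answers of the value oracle and of the feasibility oracle on
sets of accessible items. Items are opaque: an algorithm refers to them only by their places. -/
structure StreamView (ι : Type) (n M : ℕ) where
  word : Fin M → Fin (n + 1)
  occupied : ι → Bool
  value : Finset ι → ℝ
  feasible : Finset ι → Prop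

/-- The view of the memory contents `word`, with the items `c` accessible. -/
def StreamView.of {ι α : Type} [DecidableEq α] {n M : ℕ} (f : Finset α → ℝ)
    (feas : Finset α → Prop) (word : Fin M → Fin (n + 1)) (c : ι → Option α) :
    StreamView ι n M where
  word := word
  occupied i := (c i).isSome
  value Q := f (collect c Q)
  feasible Q := feas (collect c Q)

/-- The accessible items at an arrival: `none` is the place of the arriving item `a`, and
`some i` is the place of memory cell `i`. -/
def itemsOnArrival {α : Type} {M : ℕ} (item : Fin M → Option α) (a : α) :
    Option (Fin M) → Option α
  | none => some a
  | some i => item i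

/-- A randomized one-pass streaming algorithm with `M` memory cells, for streams of known
length `n`.
* `init`: the (random) initial integers; the memory holds no item at the start.
* `step`: on an arrival, given the view of the memory and of the arriving item, the (random) new
  contents: for each cell, the place from which its new item is copied (`none`: the cell is left
  without an item), and the new integers.
* `output`: after the last arrival, the (random) set of cells whose items are returned. -/
structure StreamAlg (n M : ℕ) where
  init : PMF (Fin M → Fin (n + 1))
  step : StreamView (Option (Fin M)) n M →
    PMF ((Fin M → Option (Option (Fin M))) × (Fin M → Fin (n + 1)))
  output : StreamView (Fin M) n M → PMF (Finset (Fin M))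

namespace StreamAlg

variable {n M : ℕ} {α : Type} [DecidableEq α]

/-- The law of the memory after the arrival of `a`. -/
def arrive (A : StreamAlg n M) (f : Finset α → ℝ) (feas : Finset α → Prop)
    (m : StreamMemory α n M) (a : α) : PMF (StreamMemory α n M) :=
  (A.step (StreamView.of f feas m.word (itemsOnArrival m.item a))).map fun u =>
    { item := fun i => (u.1 i).bind (itemsOnArrival m.item a)
      word := u.2 }

/-- The law of the memory after the arrivals of the items of a list, from left to right. -/
def run (A : StreamAlg n M) (f : Finset α → ℝ) (feas : Finset α → Prop) :
    StreamMemory α n M → List α → PMF (StreamMemory α n M)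
  | m, [] => PMF.pure m
  | m, a :: l => (A.arrive f feas m a).bind fun m' => run A f feas m' l

/-- The law of the returned set on a given stream. -/
def resultOn (A : StreamAlg n M) (f : Finset α → ℝ) (feas : Finset α → Prop) (l : List α) :
    PMF (Finset α) :=
  A.init.bind fun w =>
    (A.run f feas { item := fun _ => none, word := w } l).bind fun m =>
      (A.output (StreamView.of f feas m.word m.item)).map fun Q => collect m.item Q

/-- The law of the returned set in the random-order model: the `n` items of the ground set
`Fin n` arrive in a uniformly random order, independent of the coins of the algorithm. -/
def result (A : StreamAlg n M) (f : Finset (Fin n) → ℝ) (feas : Finset (Fin n) → Prop) :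
    PMF (Finset (Fin n)) :=
  (PMF.uniformOfFintype (Equiv.Perm (Fin n))).bind fun σ => A.resultOn f feas (List.ofFn σ)

/-- The algorithm always returns a feasible set, and the expected value of the returned set is at
least `r` times the value of every feasible set (hence `r` times the optimum). -/
def Achieves (A : StreamAlg n M) (r : ℝ) (f : Finset (Fin n) → ℝ)
    (feas : Finset (Fin n) → Prop) : Prop :=
  (∀ S ∈ (A.result f feas).support, feas S) ∧
    ∀ T, feas T → r * f T ≤ ∑ S : Finset (Fin n), (A.result f feas S).toReal * f S

end StreamAlg

/-- A family of matroids, each on its own ground set inside `α`, is a `p`-matchoid: every item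
lies in the ground sets of at most `p` of the matroids. -/
def IsMatchoid {α ι : Type} (p : ℕ) (N : ι → Matroid α) : Prop :=
  ∀ a : α, {i | a ∈ (N i).E}.encard ≤ p

/-- Feasibility for a matchoid: the part of `S` in each ground set is independent there. -/
def MatchoidFeasible {α ι : Type} (N : ι → Matroid α) (S : Finset α) : Prop :=
  ∀ i, (N i).Indep ((S : Set α) ∩ (N i).E)

end

/-! ### Constrained optima over a set of places or items. -/

section BestValue

/-! A random order cut at multinomial sizes puts every item in an independent uniform window out of
`m`, so only the window sizes need to be stored. Each window contributes at most one kept item, the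
one that most increases a monotone potential of the kept set `H`; at the end the best feasible
subset of the kept items is returned.

The random order enters through one fact (`kept_update`, `sum_max_weight_ge`, combined in
`sum_kept_succ_ge`). An item outside `H` has had no influence on the choices so far, so moving it to
the current window preserves `H`. Hence, given `H`, it lies in that window with probability at least
1/m, and the expected gain is at least κ = (1/m)(1 - k/m) times the sum of the gains of the single
items of a competitor `T`. The potential need not be submodular.

For a matchoid the potential is V(H), the best feasible value inside `H`. Exchanges
(`IsMatchoid.le_sum_bestValue_insert`) bound the sum of gains below by f(T) - (p+1)V(H), so each
window contracts this deficit by about 1 - (p+1)κ, and `m` windows by about exp(-(p+1)). A matroid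
is the case p = 1.

For cardinality, exchanges are too costly, so all levels V_ℓ(H), the best values with at most ℓ
items, are followed together. Adding an item of `T` to an optimal set of level ℓ bounds V_(ℓ+1);
thus a window does at least as well as the monotone linear operator `levelShift` plus f(T) times
`levelGain`. Using as potential level k after the shifts of all later windows turns this into one
telescoping sum. It is the total discounted gain of a walk that descends from level k with
probability q = kκ per window; only an early arrival at 0 costs anything, and a variance bound
(`sum_levelShift_pow_ge`) makes that cost O(ε). So O(k/ε) cells suffice here too. -/

/-- The largest value of a feasible subset of `P` with at most `ℓ` members. -/
noncomputable def bestValue {ι : Type*} (value : Finset ι → ℝ) (feas : Finset ι → Prop)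
    (P : Finset ι) (ℓ : ℕ) : ℝ :=
  sSup (value '' {Q | Q ⊆ P ∧ Q.card ≤ ℓ ∧ feas Q})

variable {ι : Type*} {value : Finset ι → ℝ} {feas : Finset ι → Prop} {P P' Q : Finset ι} {ℓ ℓ' : ℕ}

theorem finite_feasible_subsets : {Q | Q ⊆ P ∧ Q.card ≤ ℓ ∧ feas Q}.Finite :=
  P.powerset.finite_toSet.subset fun _ hQ => by simpa using hQ.1

theorem le_bestValue (hP : Q ⊆ P) (hℓ : Q.card ≤ ℓ) (hQ : feas Q) :
    value Q ≤ bestValue value feas P ℓ :=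
  le_csSup (finite_feasible_subsets.image _).bddAbove ⟨Q, ⟨hP, hℓ, hQ⟩, rfl⟩

theorem exists_eq_bestValue (h₀ : feas ∅) (value : Finset ι → ℝ) (P : Finset ι) (ℓ : ℕ) :
    ∃ Q, (Q ⊆ P ∧ Q.card ≤ ℓ ∧ feas Q) ∧ value Q = bestValue value feas P ℓ := by
  have hne : (value '' {Q | Q ⊆ P ∧ Q.card ≤ ℓ ∧ feas Q}).Nonempty :=
    ⟨_, ∅, ⟨by simp, by simp, h₀⟩, rfl⟩
  obtain ⟨Q, hQ, h⟩ := hne.csSup_mem (finite_feasible_subsets.image _)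
  exact ⟨Q, hQ, h⟩

theorem bestValue_mono (h₀ : feas ∅) (hP : P ⊆ P') (hℓ : ℓ ≤ ℓ') :
    bestValue value feas P ℓ ≤ bestValue value feas P' ℓ' := by
  obtain ⟨Q, ⟨h1, h2, h3⟩, h⟩ := exists_eq_bestValue h₀ value P ℓ
  rw [← h]
  exact le_bestValue (h1.trans hP) (h2.trans hℓ) h3

theorem bestValue_nonneg (h : ∀ Q, 0 ≤ value Q) : 0 ≤ bestValue value feas P ℓ :=
  Real.sSup_nonneg (by rintro _ ⟨Q, -, rfl⟩; exact h Q)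

theorem mem_collect {α : Type*} [DecidableEq α] {c : ι → Option α} {a : α} :
    a ∈ collect c Q ↔ ∃ i ∈ Q, c i = some a := by
  simp [collect]

/-- Translates from places, which the algorithm sees, to items. Sizes agree: collecting never
increases the cardinality, and one place per item is enough in the other direction. -/
theorem bestValue_collect {α : Type*} [DecidableEq α] (f : Finset α → ℝ)
    (feas : Finset α → Prop) (c : ι → Option α) (P : Finset ι) :
    bestValue (fun Q => f (collect c Q)) (fun Q => feas (collect c Q)) P =
      bestValue f feas (collect c P) := by
  funext ℓ
  unfold bestValue
  congr 1
  ext x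
  constructor
  · rintro ⟨Q, ⟨h1, h2, h3⟩, rfl⟩
    refine ⟨collect c Q, ⟨Finset.biUnion_subset_biUnion_of_subset_left _ h1, ?_, h3⟩, rfl⟩
    refine (Finset.card_biUnion_le_card_mul _ _ 1 fun i _ => ?_).trans (by simpa using h2)
    cases c i <;> simp
  · rintro ⟨R, ⟨h1, h2, h3⟩, rfl⟩
    have : ∀ a ∈ R, ∃ i ∈ P, c i = some a := fun a ha => mem_collect.1 (h1 ha)
    classical
    choose g hgP hg using this
    have hR : collect c (R.attach.image fun a : R => g a a.2) = R := by
      ext a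
      rw [mem_collect]
      constructor
      · rintro ⟨i, hi, ha⟩
        obtain ⟨b, -, rfl⟩ := Finset.mem_image.1 hi
        rw [hg] at ha
        exact Option.some.inj ha ▸ b.2
      · exact fun ha => ⟨g a ha, Finset.mem_image.2 ⟨⟨a, ha⟩, Finset.mem_attach _ _, rfl⟩, hg a ha⟩
    refine ⟨R.attach.image fun a : R => g a a.2, ⟨?_, ?_, by simpa only [hR] using h3⟩, by
      simp only [hR]⟩
    · exact Finset.image_subset_iff.2 fun a _ => hgP a a.2
    · exact Finset.card_image_le.trans (by simpa using h2)

end BestValue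

/-! ### Greedy selection and its insensitivity to items that are not selected. -/

section Selection

variable {α : Type*} [DecidableEq α]

open Classical in
/-- The better one of the candidate `c` and the item `a`, as additions to `H`; ties are resolved in
favour of `c`. -/
noncomputable def better (ψ : Finset α → ℝ) (H : Finset α) (c : Option α) (a : α) : Option α :=
  if ψ (H ∪ c.toFinset) < ψ (insert a H) then some a else c

/-- The first item of a list whose addition to `H` gives the largest value of `ψ`, if that is an
improvement. -/
noncomputable def pick (ψ : Finset α → ℝ) (H : Finset α) (l : List α) : Option α :=
  l.foldl (better ψ H) none

/-- The items kept from the first `j` windows. -/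
noncomputable def kept (Ψ : ℕ → Finset α → ℝ) (W : ℕ → List α) : ℕ → Finset α
  | 0 => ∅
  | j + 1 => kept Ψ W j ∪ (pick (Ψ j) (kept Ψ W j) (W j)).toFinset

variable {ψ : Finset α → ℝ} {H : Finset α} {Ψ : ℕ → Finset α → ℝ} {W : ℕ → List α}

theorem le_foldl_better (l : List α) (c : Option α) :
    ψ (H ∪ c.toFinset) ≤ ψ (H ∪ (l.foldl (better ψ H) c).toFinset) ∧
      ∀ a ∈ l, ψ (insert a H) ≤ ψ (H ∪ (l.foldl (better ψ H) c).toFinset) := by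
  induction l generalizing c with
  | nil => simp
  | cons b l ih =>
    have h : ψ (H ∪ c.toFinset) ≤ ψ (H ∪ (better ψ H c b).toFinset) ∧
        ψ (insert b H) ≤ ψ (H ∪ (better ψ H c b).toFinset) := by
      unfold better
      split_ifs with h
      · simp only [Option.toFinset_some, Finset.union_singleton]
        exact ⟨h.le, le_rfl⟩
      · exact ⟨le_rfl, not_lt.1 h⟩
    simp only [List.foldl_cons, List.mem_cons, forall_eq_or_imp]
    obtain ⟨h1, h2⟩ := ih (better ψ H c b)
    exact ⟨h.1.trans h1, h.2.trans h1, h2⟩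

/-- The scans with and without `e` differ only while `e` is the candidate, and then the other
candidate is no better than `e`. An item that displaces `e` therefore displaces the other one too,
and the scans merge. -/
theorem foldl_better_filter (e : α) (l : List α) (c c' : Option α)
    (h : c' = c ∨ c = some e ∧ ψ (H ∪ c'.toFinset) ≤ ψ (insert e H)) :
    (l.filter (· ≠ e)).foldl (better ψ H) c' = l.foldl (better ψ H) c ∨
      l.foldl (better ψ H) c = some e := by
  induction l generalizing c c' with
  | nil => simpa using h.imp_right And.left
  | cons b l ih =>
    by_cases hb : b = e
    · subst hb
      simp only [ne_eq, not_true_eq_false, decide_false, Bool.false_eq_true, not_false_eq_true,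
        List.filter_cons_of_neg, List.foldl_cons]
      refine ih _ _ ?_
      unfold better
      split_ifs with hlt
      · rcases h with rfl | ⟨rfl, h⟩
        · exact .inr ⟨rfl, hlt.le⟩
        · exact .inr ⟨rfl, h⟩
      · exact h
    · simp only [ne_eq, hb, not_false_eq_true, decide_true, List.filter_cons_of_pos,
        List.foldl_cons]
      refine ih _ _ ?_
      rcases h with rfl | ⟨rfl, h⟩
      · exact .inl rfl
      · have he : H ∪ (some e).toFinset = insert e H := by simp
        unfold better
        rw [he]
        by_cases h1 : ψ (insert e H) < ψ (insert b H)
        · rw [if_pos h1, if_pos (h.trans_lt h1)]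
          exact .inl rfl
        · rw [if_neg h1]
          refine .inr ⟨rfl, ?_⟩
          split_ifs
          · simpa using h1
          · exact h

theorem pick_filter_ne {e : α} {l : List α} (h : pick ψ H l ≠ some e) :
    pick ψ H (l.filter (· ≠ e)) = pick ψ H l :=
  (foldl_better_filter e l none none (.inl rfl)).resolve_right h

theorem kept_mono : Monotone (kept Ψ W) :=
  monotone_nat_of_le_succ fun _ => Finset.subset_union_left

/-- The items of the list `L` in window `j`, where `X` assigns windows to items. -/
def window {m : ℕ} (L : List α) (X : α → Fin m) (j : ℕ) : List α :=
  L.filter fun a => (X a).val = j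

/-- Windows before `j` can only lose `e` by the move, and none of them selected it. -/
theorem kept_update {m : ℕ} (L : List α) (X : α → Fin m) {e : α} (j : Fin m)
    (he : e ∉ kept Ψ (window L X) j) :
    kept Ψ (window L (Function.update X e j)) j = kept Ψ (window L X) j := by
  suffices h : ∀ i ≤ j.val, kept Ψ (window L (Function.update X e j)) i = kept Ψ (window L X) i from
    h _ le_rfl
  intro i hi
  induction i with
  | zero => rfl
  | succ i ih =>
    have hw : window L (Function.update X e j) i = (window L X i).filter (· ≠ e) := by
      unfold window
      rw [List.filter_filter]
      refine List.filter_congr fun a _ => ?_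
      by_cases ha : a = e
      · subst ha
        have : j.val ≠ i := by omega
        simp [this]
      · simp [ha]
    unfold kept
    rw [ih (by omega), hw, pick_filter_ne]
    intro h
    refine he (kept_mono hi ?_)
    unfold kept
    simp [h]

end Selection

/-! ### Expected gain of one random window. -/

section Counting

/-- Expected maximum over a random window: if a set `A` of assignments is stable under moving the
items of `B` to window `j`, then the maximal weight of an item of `B` in window `j` has on average
at least the fraction `(1 - |B| / m) / m` of the total weight of `B`. -/
theorem sum_max_weight_ge {α : Type*} [Fintype α] [DecidableEq α] {m : ℕ} (j : Fin m) (y : α → ℝ)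
    (B : Finset α) (hB : B.card ≤ m) (hy : ∀ e ∈ B, 0 ≤ y e)
    (A : Finset (α → Fin m)) (hA : ∀ X ∈ A, ∀ e ∈ B, Function.update X e j ∈ A)
    (g : (α → Fin m) → ℝ) (hg0 : ∀ X ∈ A, 0 ≤ g X)
    (hg : ∀ X ∈ A, ∀ e ∈ B, X e = j → y e ≤ g X) :
    A.card * (1 / m * (1 - B.card / m) * ∑ e ∈ B, y e) ≤ ∑ X ∈ A, g X := by
  -- Remove the heaviest item `e`: if it lies in window `j` it alone bounds `g`; the remaining
  -- assignments are still stable under moves of the lighter items.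
  induction B using Finset.induction_on_max_value y generalizing A with
  | empty => simpa using Finset.sum_nonneg hg0
  | insert e B heB hmax ih =>
    have hm : (0 : ℝ) < m := by exact_mod_cast j.pos
    rw [Finset.card_insert_of_notMem heB] at hB ⊢
    have hBm : (B.card : ℝ) + 1 ≤ m := by exact_mod_cast hB
    have hye := hy e (Finset.mem_insert_self _ _)
    have h1 := ih (by omega) (fun a ha => hy a (Finset.mem_insert_of_mem ha))
      (A.filter fun X => X e ≠ j)
      (fun X hX a ha => by
        rw [Finset.mem_filter] at hX ⊢
        refine ⟨hA X hX.1 a (Finset.mem_insert_of_mem ha), ?_⟩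
        rw [Function.update_of_ne (by rintro rfl; exact heB ha)]
        exact hX.2)
      (fun X hX => hg0 X (Finset.mem_filter.1 hX).1)
      (fun X hX a ha => hg X (Finset.mem_filter.1 hX).1 a (Finset.mem_insert_of_mem ha))
    have h2 : ((A.filter fun X => X e = j).card : ℝ) * y e ≤ ∑ X ∈ A with X e = j, g X := by
      rw [← nsmul_eq_mul]
      refine Finset.card_nsmul_le_sum _ _ _ fun X hX => ?_
      rw [Finset.mem_filter] at hX
      exact hg X hX.1 e (Finset.mem_insert_self _ _) hX.2
    -- Moving `e` to window `j` is at most `m`-to-one, the fibre being determined by the old window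
    -- of `e`.
    have h3 : A.card ≤ m * (A.filter fun X => X e = j).card := by
      refine Finset.card_le_mul_card_image_of_maps_to (f := fun X => Function.update X e j)
        (fun X hX => ?_) m fun Z _ => ?_
      · simpa using hA X hX e (Finset.mem_insert_self _ _)
      · calc _ ≤ (Finset.univ.image fun v : Fin m => Function.update Z e v).card := by
              refine Finset.card_le_card fun X hX => ?_
              rw [Finset.mem_filter] at hX
              rw [Finset.mem_image]
              refine ⟨X e, Finset.mem_univ _, ?_⟩
              rw [← hX.2]
              simp
          _ ≤ m := Finset.card_image_le.trans (by simp)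
    have h3' : (A.card : ℝ) ≤ m * (A.filter fun X => X e = j).card := by exact_mod_cast h3
    have h4 : (A.card : ℝ) = (A.filter fun X => X e = j).card +
        (A.filter fun X => X e ≠ j).card := by
      exact_mod_cast (Finset.card_filter_add_card_filter_not (fun X : α → Fin m => X e = j)).symm
    have h5 : ∑ X ∈ A, g X = (∑ X ∈ A with X e = j, g X) + ∑ X ∈ A with X e ≠ j, g X :=
      (Finset.sum_filter_add_sum_filter_not _ _ _).symm
    have h6 : ∑ a ∈ B, y a ≤ B.card * y e := by
      rw [← nsmul_eq_mul]
      exact Finset.sum_le_card_nsmul _ _ _ hmax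
    have h7 : 0 ≤ ∑ a ∈ B, y a :=
      Finset.sum_nonneg fun a ha => hy a (Finset.mem_insert_of_mem ha)
    rw [Finset.sum_insert heB, h5]
    refine le_trans ?_ (add_le_add h2 h1)
    set s := ∑ a ∈ B, y a
    set a₁ : ℝ := ((A.filter fun X => X e = j).card : ℝ)
    set a₂ : ℝ := ((A.filter fun X => X e ≠ j).card : ℝ)
    set b : ℝ := (B.card : ℝ)
    have hb : 0 ≤ b := Nat.cast_nonneg _
    push_cast
    set u : ℝ := 1 / m with hu
    have hum : u * m = 1 := by rw [hu]; field_simp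
    have hu0 : 0 < u := by positivity
    have hbu : (b + 1) * u ≤ 1 := by nlinarith
    have e1 : (b + 1) / m = (b + 1) * u := by rw [hu]; ring
    have e2 : b / m = b * u := by rw [hu]; ring
    rw [e1, e2]
    have ha : u * (a₁ + a₂) ≤ a₁ := by rw [← h4]; nlinarith
    have ha₂ : 0 ≤ a₂ := Nat.cast_nonneg _
    have ha₁ : 0 ≤ a₁ := Nat.cast_nonneg _
    rw [h4]
    have k1 : u * (1 - b * u) * s ≤ y e := by
      have hus : u * s ≤ u * (b * y e) := mul_le_mul_of_nonneg_left h6 hu0.le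
      have hby : b * u * y e ≤ 1 * y e := mul_le_mul_of_nonneg_right (by linarith) hye
      have hbus : 0 ≤ b * u * (u * s) := by positivity
      linarith
    -- By `k1`, weight on the case `X e = j` only helps, so its least possible share 1/m is the
    -- worst case.
    have k2 : 0 ≤ (a₁ - u * (a₁ + a₂)) * (y e - u * (1 - b * u) * s) :=
      mul_nonneg (by linarith) (by linarith)
    have k3 : 0 ≤ (a₁ + a₂) * u * ((b + 1) * u) * y e := by positivity
    have k4 : 0 ≤ (a₁ + a₂) * u * (b * u * u) * s := by positivity
    linarith only [k2, k3, k4]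

/-- Condition on the kept set `H`: by `kept_update` each fibre is stable under moving items of `T \
H` to window `j`, so `sum_max_weight_ge` applies. Items of `T` in `H` have zero gain. -/
theorem sum_kept_succ_ge {α : Type*} [Fintype α] [DecidableEq α] {m k : ℕ} {Ψ : ℕ → Finset α → ℝ}
    (j : Fin m) (hΨ : Monotone (Ψ j)) (L : List α) (hL : ∀ a, a ∈ L) (T : Finset α)
    (hT : T.card ≤ k) (hk : k ≤ m) :
    ∑ X : α → Fin m, (Ψ j (kept Ψ (window L X) j) + 1 / m * (1 - k / m) *
        ∑ e ∈ T, (Ψ j (insert e (kept Ψ (window L X) j)) - Ψ j (kept Ψ (window L X) j))) ≤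
      ∑ X : α → Fin m, Ψ j (kept Ψ (window L X) (j + 1)) := by
  have hm : (0 : ℝ) < m := by exact_mod_cast j.pos
  rw [← Finset.sum_fiberwise (g := fun X : α → Fin m => kept Ψ (window L X) j),
    ← Finset.sum_fiberwise (g := fun X : α → Fin m => kept Ψ (window L X) j)
      (f := fun X => Ψ j (kept Ψ (window L X) (j + 1)))]
  refine Finset.sum_le_sum fun H _ => ?_
  set A : Finset (α → Fin m) := {X | kept Ψ (window L X) j = H} with hAdef
  have hsucc : ∀ X ∈ A, kept Ψ (window L X) (j + 1) =
      H ∪ (pick (Ψ j) H (window L X j)).toFinset := by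
    intro X hX
    have hX : kept Ψ (window L X) j = H := by simpa [hAdef] using hX
    rw [kept, hX]
  have key := sum_max_weight_ge j (fun e => Ψ j (insert e H) - Ψ j H) (T \ H)
    ((Finset.card_le_card Finset.sdiff_subset).trans (hT.trans hk))
    (fun e _ => sub_nonneg.2 (hΨ (Finset.subset_insert _ _))) A
    (fun X hX e he => by
      have hX' : kept Ψ (window L X) j = H := by simpa [hAdef] using hX
      have : kept Ψ (window L (Function.update X e j)) j = H := by
        rw [kept_update L X j (by rw [hX']; exact (Finset.mem_sdiff.1 he).2), hX']
      simpa [hAdef] using this)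
    (fun X => Ψ j (kept Ψ (window L X) (j + 1)) - Ψ j H)
    (fun X hX => by
      rw [hsucc X hX, sub_nonneg]
      exact hΨ Finset.subset_union_left)
    (fun X hX e he hXe => by
      rw [hsucc X hX]
      refine sub_le_sub_right ((le_foldl_better _ none).2 e ?_) _
      simp [window, hL, hXe])
  have hsum : ∑ e ∈ T, (Ψ j (insert e H) - Ψ j H) = ∑ e ∈ T \ H, (Ψ j (insert e H) - Ψ j H) := by
    refine (Finset.sum_subset Finset.sdiff_subset fun e he he' => ?_).symm
    have : e ∈ H := by simpa [he] using he'
    rw [Finset.insert_eq_of_mem this, sub_self]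
  have h0 : 0 ≤ ∑ e ∈ T \ H, (Ψ j (insert e H) - Ψ j H) :=
    Finset.sum_nonneg fun e _ => sub_nonneg.2 (hΨ (Finset.subset_insert _ _))
  have hc : ((T \ H).card : ℝ) ≤ k := by
    exact_mod_cast (Finset.card_le_card Finset.sdiff_subset).trans hT
  have hsub : ∑ X ∈ A, (Ψ j (kept Ψ (window L X) (j + 1)) - Ψ j H) =
      ∑ X ∈ A, Ψ j (kept Ψ (window L X) (j + 1)) - A.card * Ψ j H := by
    rw [Finset.sum_sub_distrib, Finset.sum_const, nsmul_eq_mul]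
  calc _ = ∑ X ∈ A, (Ψ j H + 1 / m * (1 - k / m) *
        ∑ e ∈ T \ H, (Ψ j (insert e H) - Ψ j H)) := by
        refine Finset.sum_congr rfl fun X hX => ?_
        have hX : kept Ψ (window L X) j = H := by simpa [hAdef] using hX
        rw [hX, hsum]
    _ = A.card * Ψ j H + A.card * (1 / m * (1 - k / m) *
        ∑ e ∈ T \ H, (Ψ j (insert e H) - Ψ j H)) := by
        rw [Finset.sum_const, nsmul_eq_mul, mul_add]
    _ ≤ A.card * Ψ j H + A.card * (1 / m * (1 - (T \ H).card / m) *
        ∑ e ∈ T \ H, (Ψ j (insert e H) - Ψ j H)) := by gcongr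
    _ ≤ _ := by linarith

end Counting

/-! ### The streaming algorithm and its identification with greedy selection. -/

section Algorithm

variable {n m : ℕ}

/-- Cell `i` is active if it belongs to the first window with remaining arrivals. -/
def ActiveCell (word : Fin m → Fin (n + 1)) (i : Fin m) : Prop :=
  (word i).val ≠ 0 ∧ ∀ i' < i, (word i').val = 0

/-- The places of the items kept in the cells before `i`, and the place `x`. -/
def placesBefore (i : Fin m) (x : Option (Fin m)) : Finset (Option (Fin m)) :=
  insert x ((Finset.Iio i).map Function.Embedding.some)

/-- The numbers of items in the windows. -/
def windowSizes (X : Fin n → Fin m) (i : Fin m) : Fin (n + 1) :=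
  ⟨(Finset.univ.filter fun a => X a = i).card,
    Nat.lt_succ_of_le ((Finset.card_le_univ _).trans (by simp))⟩

open Classical in
/-- The greedy algorithm with a partition of the stream into `m` random windows. Cell `i` keeps the
best item of window `i` in terms of `score i`, evaluated on the sequence of optimal values of the
cardinality-constrained subproblems on the kept items. An optimal subset of the kept items, of size
at most `K`, is returned. -/
noncomputable def windowGreedy (n m : ℕ) [NeZero m] (score : ℕ → (ℕ → ℝ) → ℝ) (K : ℕ) :
    StreamAlg n m where
  init := (PMF.uniformOfFintype (Fin n → Fin m)).map windowSizes
  step v := PMF.pure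
    (fun i => some (if ActiveCell v.word i ∧
        score i (bestValue v.value v.feasible (placesBefore i (some i))) <
          score i (bestValue v.value v.feasible (placesBefore i none))
        then none else some i),
      fun i => if ActiveCell v.word i then ⟨(v.word i).val - 1, by omega⟩ else v.word i)
  output v := PMF.pure (Classical.epsilon fun Q =>
    (Q ⊆ Finset.univ ∧ Q.card ≤ K ∧ v.feasible Q) ∧
      v.value Q = bestValue v.value v.feasible Finset.univ K)

variable {α : Type} [DecidableEq α] (score : ℕ → (ℕ → ℝ) → ℝ) (f : Finset α → ℝ)
  (feas : Finset α → Prop)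

/-- The potential of a set of kept items. -/
noncomputable def potential (i : ℕ) (H : Finset α) : ℝ := score i (bestValue f feas H)

open Classical in
/-- The memory of the greedy algorithm after the arrival of `a`. -/
noncomputable def greedyArrive (μ : StreamMemory α n m) (a : α) : StreamMemory α n m where
  item i := if ActiveCell μ.word i then
    better (potential score f feas i) (collect μ.item (Finset.Iio i)) (μ.item i) a else μ.item i
  word i := if ActiveCell μ.word i then ⟨(μ.word i).val - 1, by omega⟩ else μ.word i

theorem collect_insert {ι : Type*} [DecidableEq ι] (c : ι → Option α) (i : ι) (Q : Finset ι) :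
    collect c (insert i Q) = (c i).toFinset ∪ collect c Q := by
  simp [collect]

theorem collect_placesBefore (c : Fin m → Option α) (a : α) (i : Fin m) (x : Option (Fin m)) :
    collect (itemsOnArrival c a) (placesBefore i x) =
      (itemsOnArrival c a x).toFinset ∪ collect c (Finset.Iio i) := by
  rw [placesBefore, collect_insert]
  congr 1
  ext b
  simp [mem_collect, itemsOnArrival]

theorem windowGreedy_arrive [NeZero m] (K : ℕ) (μ : StreamMemory α n m) (a : α) :
    (windowGreedy n m score K).arrive f feas μ a = PMF.pure (greedyArrive score f feas μ a) := by
  unfold StreamAlg.arrive windowGreedy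
  rw [PMF.pure_map]
  congr 1
  unfold greedyArrive
  congr 1
  funext i
  have hb : ∀ P, bestValue (StreamView.of f feas μ.word (itemsOnArrival μ.item a)).value
      (StreamView.of f feas μ.word (itemsOnArrival μ.item a)).feasible P =
        bestValue f feas (collect (itemsOnArrival μ.item a) P) :=
    bestValue_collect f feas _
  have hnew : collect (itemsOnArrival μ.item a) (placesBefore i none) =
      insert a (collect μ.item (Finset.Iio i)) := by
    rw [collect_placesBefore]
    rfl
  have hold : collect (itemsOnArrival μ.item a) (placesBefore i (some i)) =
      collect μ.item (Finset.Iio i) ∪ (μ.item i).toFinset := by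
    rw [collect_placesBefore, Finset.union_comm]
    rfl
  have hpnew := congrArg (score i) (hb (placesBefore i none))
  have hpold := congrArg (score i) (hb (placesBefore i (some i)))
  rw [hnew] at hpnew
  rw [hold] at hpold
  unfold better potential
  rw [← hpnew, ← hpold]
  dsimp only
  generalize score i (bestValue _ _ (placesBefore i none)) = x
  generalize score i (bestValue _ _ (placesBefore i (some i))) = y
  by_cases h : ActiveCell μ.word i
  · have h' : ActiveCell (StreamView.of f feas μ.word (itemsOnArrival μ.item a)).word i := h
    by_cases hxy : y < x <;> simp [h, h', hxy, itemsOnArrival]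
  · have h' : ¬ ActiveCell (StreamView.of f feas μ.word (itemsOnArrival μ.item a)).word i := h
    simp [h, h', itemsOnArrival]

theorem windowGreedy_run [NeZero m] (K : ℕ) (μ : StreamMemory α n m) (l : List α) :
    (windowGreedy n m score K).run f feas μ l =
      PMF.pure (l.foldl (greedyArrive score f feas) μ) := by
  induction l generalizing μ with
  | nil => rfl
  | cons a l ih =>
    rw [StreamAlg.run, windowGreedy_arrive, PMF.pure_bind, ih]
    rfl

/-- The integer of cell `j` counts the arrivals left in its window, so `j` stays the only active
cell throughout `l`, and the items it is compared with do not change. -/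
theorem foldl_greedyArrive (j : Fin m) (l : List α) (μ : StreamMemory α n m)
    (h0 : ∀ i < j, (μ.word i).val = 0) (hj : (μ.word j).val = l.length) :
    l.foldl (greedyArrive score f feas) μ =
      { item := Function.update μ.item j (l.foldl
          (better (potential score f feas j) (collect μ.item (Finset.Iio j))) (μ.item j))
        word := Function.update μ.word j 0 } := by
  induction l generalizing μ with
  | nil =>
    have h : μ.word j = 0 := Fin.ext hj
    rw [← h]
    simp
  | cons a l ih =>
    have hact : ∀ i, ActiveCell μ.word i ↔ i = j := by
      intro i
      constructor
      · rintro ⟨h1, h2⟩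
        rcases lt_trichotomy i j with h | h | h
        · exact absurd (h0 i h) h1
        · exact h
        · simp [h2 j h] at hj
      · rintro rfl
        exact ⟨by simp [hj], h0⟩
    set c := better (potential score f feas j) (collect μ.item (Finset.Iio j)) (μ.item j) a with hc
    have hstep : greedyArrive score f feas μ a =
        { item := Function.update μ.item j c
          word := Function.update μ.word j ⟨(μ.word j).val - 1, by omega⟩ } := by
      unfold greedyArrive
      congr 1 <;> funext i <;> by_cases hi : i = j
      · subst hi; simp [hact, hc]
      · simp [hact, hi]
      · subst hi; simp [hact]
      · simp [hact, hi]
    have hcol : collect (Function.update μ.item j c) (Finset.Iio j) =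
        collect μ.item (Finset.Iio j) := by
      refine Finset.biUnion_congr rfl fun i hi => ?_
      rw [Function.update_of_ne (Finset.mem_Iio.1 hi).ne]
    rw [List.foldl_cons, hstep, ih]
    · simp only [hcol]
      simp [hc]
    · intro i hi
      simpa [hi.ne] using h0 i hi
    · simp [hj]

/-- The stream in which the windows arrive one after the other. -/
def stream (L : List α) (X : α → Fin m) : List α :=
  (List.range m).flatMap (window L X)

theorem collect_foldl_greedyArrive (W : ℕ → List α) (d : ℕ) (j : ℕ) (hd : j + d = m)
    (μ : StreamMemory α n m) (h0 : ∀ i : Fin m, i.val < j → (μ.word i).val = 0)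
    (hw : ∀ i : Fin m, j ≤ i.val → (μ.word i).val = (W i).length)
    (hi : ∀ i : Fin m, j ≤ i.val → μ.item i = none)
    (hH : collect μ.item (Finset.univ.filter fun i => i.val < j) =
      kept (potential score f feas) W j) :
    collect (((List.range' j d).flatMap W).foldl (greedyArrive score f feas) μ).item
      Finset.univ = kept (potential score f feas) W m := by
  induction d generalizing j μ with
  | zero =>
    obtain rfl : j = m := by omega
    rw [← hH]
    simp
  | succ d ih =>
    have hjm : j < m := by omega
    rw [List.range'_succ, List.flatMap_cons, List.foldl_append,
      foldl_greedyArrive score f feas ⟨j, hjm⟩ (W j) μ (fun i h => h0 i h) (hw ⟨j, hjm⟩ le_rfl)]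
    have hIio : Finset.Iio (⟨j, hjm⟩ : Fin m) = Finset.univ.filter fun i => i.val < j := by
      ext i
      simp [Fin.lt_def]
    refine ih (j + 1) (by omega) _ (fun i h => ?_) (fun i h => ?_) (fun i h => ?_) ?_
    · by_cases hij : i = ⟨j, hjm⟩
      · subst hij; simp
      · have : i.val ≠ j := fun h => hij (Fin.ext h)
        simpa [hij] using h0 i (by omega)
    · have hij : i ≠ ⟨j, hjm⟩ := by rintro rfl; simp at h
      simpa [hij] using hw i (by omega)
    · have hij : i ≠ ⟨j, hjm⟩ := by rintro rfl; simp at h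
      simpa [hij] using hi i (by omega)
    · have hset : (Finset.univ.filter fun i : Fin m => i.val < j + 1) =
          insert ⟨j, hjm⟩ (Finset.univ.filter fun i => i.val < j) := by
        ext i
        simp [Fin.ext_iff]
        omega
      rw [hset, collect_insert, kept, ← hH, Finset.union_comm]
      congr 1
      · refine Finset.biUnion_congr rfl fun i hi => ?_
        have hij : i ≠ ⟨j, hjm⟩ := by rintro rfl; simp at hi
        simp [hij]
      · simp only [Function.update_self, hi ⟨j, hjm⟩ le_rfl, hIio, hH, pick]

theorem collect_foldl_stream {L : List (Fin n)} (hL : L.Perm (List.finRange n))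
    (f : Finset (Fin n) → ℝ) (feas : Finset (Fin n) → Prop) (X : Fin n → Fin m) :
    collect ((stream L X).foldl (greedyArrive score f feas)
      { item := fun _ => none, word := windowSizes X }).item Finset.univ =
        kept (potential score f feas) (window L X) m := by
  rw [stream, List.range_eq_range']
  refine collect_foldl_greedyArrive score f feas (window L X) m 0 (by omega) _ (by simp)
    (fun i _ => ?_) (fun _ _ => rfl) (by simp [collect, kept])
  unfold window
  rw [(hL.filter _).length_eq, ← List.toFinset_card_of_nodup ((List.nodup_finRange n).filter _)]
  change (Finset.univ.filter fun a => X a = i).card = _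
  congr 1
  ext a
  simp [Fin.ext_iff]

end Algorithm

/-! ### From random permutations to independent uniform windows. -/

section RandomOrder

variable {n m : ℕ}

theorem exists_stream_finRange (Z : Fin n → Fin m) :
    ∃ τ : Equiv.Perm (Fin n), stream (List.finRange n) Z = List.ofFn τ := by
  have hmem : ∀ a, a ∈ stream (List.finRange n) Z := fun a =>
    List.mem_flatMap.2 ⟨(Z a).val, by simp, by simp [window]⟩
  have hnd : (stream (List.finRange n) Z).Nodup := by
    rw [stream, List.nodup_flatMap]
    refine ⟨fun j _ => (List.nodup_finRange n).filter _, ?_⟩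
    refine (List.nodup_range (n := m)).imp fun {i j} hij => ?_
    rw [Function.onFun, List.disjoint_left]
    intro a ha hb
    simp only [window, List.mem_filter, List.mem_finRange, true_and, decide_eq_true_eq] at ha hb
    exact hij (ha.symm.trans hb)
  have hlen : (stream (List.finRange n) Z).length = n := by
    rw [← List.toFinset_card_of_nodup hnd, Finset.card_eq_of_equiv_fin]
    exact (Equiv.subtypeUnivEquiv fun a => by simpa using hmem a)
  let e := (finCongr hlen.symm).trans (hnd.getEquivOfForallMemList _ hmem)
  refine ⟨e, ?_⟩
  refine List.ext_get (by simp [hlen]) fun i h1 h2 => ?_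
  simp [e]

theorem stream_ofFn (ρ : Equiv.Perm (Fin n)) (X : Fin n → Fin m) :
    stream (List.ofFn ρ) X = (stream (List.finRange n) (X ∘ ρ)).map ρ := by
  unfold stream window
  rw [List.map_flatMap, List.ofFn_eq_map]
  refine List.flatMap_congr fun j _ => ?_
  rw [List.filter_map]
  rfl

/-- A uniformly random order, cut into windows of random sizes, is a uniformly random assignment of
the items to the windows followed by a random order within the windows. -/
theorem sum_perm_eq_sum_stream (G : List (Fin n) → (Fin m → Fin (n + 1)) → ℝ) :
    ∑ σ : Equiv.Perm (Fin n), ∑ X : Fin n → Fin m, G (List.ofFn σ) (windowSizes X) =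
      ∑ ρ : Equiv.Perm (Fin n), ∑ X : Fin n → Fin m,
        G (stream (List.ofFn ρ) X) (windowSizes X) := by
  choose τ hτ using exists_stream_finRange (n := n) (m := m)
  have hsize : ∀ (ρ : Equiv.Perm (Fin n)) (X : Fin n → Fin m),
      windowSizes (X ∘ ρ) = windowSizes X := by
    intro ρ X
    funext i
    refine Fin.ext ?_
    change (Finset.univ.filter fun a => X (ρ a) = i).card = (Finset.univ.filter fun a => X a = i).card
    exact Finset.card_equiv ρ fun a => by simp
  -- Substitute `Z = X ∘ ρ`; the stream becomes `ρ * τ Z`, and for fixed `Z` right multiplication by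
  -- `τ Z` permutes the orders.
  have h1 : ∀ ρ : Equiv.Perm (Fin n), ∑ X : Fin n → Fin m,
      G (stream (List.ofFn ρ) X) (windowSizes X) =
      ∑ Z : Fin n → Fin m, G (List.ofFn (ρ * τ Z : Equiv.Perm (Fin n))) (windowSizes Z) := by
    intro ρ
    rw [← Equiv.sum_comp (Equiv.arrowCongr ρ.symm (Equiv.refl (Fin m))) fun Z : Fin n → Fin m =>
      G (List.ofFn (ρ * τ Z : Equiv.Perm (Fin n))) (windowSizes Z)]
    refine Finset.sum_congr rfl fun X _ => ?_
    have : (Equiv.arrowCongr ρ.symm (Equiv.refl (Fin m))) X = X ∘ ρ := rfl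
    rw [this, hsize, stream_ofFn, hτ, List.map_ofFn]
    rfl
  simp_rw [h1]
  rw [Finset.sum_comm, Finset.sum_comm (γ := Equiv.Perm (Fin n))]
  refine Finset.sum_congr rfl fun Z _ => ?_
  exact (Equiv.sum_comp (Equiv.mulRight (τ Z))
    fun σ : Equiv.Perm (Fin n) => G (List.ofFn σ) (windowSizes Z)).symm

theorem PMF.sum_toReal_bind_uniform {ι β : Type} [Fintype ι] [Nonempty ι] [Fintype β]
    (g : ι → PMF β) (F : β → ℝ) :
    ∑ b, (((PMF.uniformOfFintype ι).bind g) b).toReal * F b =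
      (Fintype.card ι : ℝ)⁻¹ * ∑ i, ∑ b, (g i b).toReal * F b := by
  have h : ∀ b, (((PMF.uniformOfFintype ι).bind g) b).toReal =
      (Fintype.card ι : ℝ)⁻¹ * ∑ i, (g i b).toReal := by
    intro b
    rw [PMF.bind_apply, tsum_fintype, ENNReal.toReal_sum, Finset.mul_sum]
    · simp
    · intro i _
      exact ENNReal.mul_ne_top (PMF.apply_ne_top _ _) (PMF.apply_ne_top _ _)
  simp_rw [h, mul_assoc, Finset.sum_mul]
  rw [← Finset.mul_sum, Finset.sum_comm]

/-- Once windows are independent of the order, the order inside them is irrelevant: a bound averaged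
over the `m ^ n` assignments is required for each fixed list `L`. -/
theorem windowGreedy_achieves [NeZero m] {f : Finset (Fin n) → ℝ} {feas : Finset (Fin n) → Prop}
    (h₀ : feas ∅) (score : ℕ → (ℕ → ℝ) → ℝ) (K : ℕ) (r : ℝ)
    (h : ∀ T, feas T → ∀ L : List (Fin n), (∀ a, a ∈ L) → (m : ℝ) ^ n * (r * f T) ≤
      ∑ X : Fin n → Fin m,
        bestValue f feas (kept (potential score f feas) (window L X) m) K) :
    (windowGreedy n m score K).Achieves r f feas := by
  classical
  let mem (l : List (Fin n)) (w : Fin m → Fin (n + 1)) : StreamMemory (Fin n) n m :=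
    l.foldl (greedyArrive score f feas) { item := fun _ => none, word := w }
  have hout : ∀ l w, ∃ S, (feas S ∧ f S = bestValue f feas (collect (mem l w).item Finset.univ) K) ∧
      ((windowGreedy n m score K).output
        (StreamView.of f feas (mem l w).word (mem l w).item)).map (collect (mem l w).item) =
          PMF.pure S := by
    intro l w
    unfold windowGreedy
    rw [PMF.pure_map]
    refine ⟨_, ?_, rfl⟩
    have := Classical.epsilon_spec (exists_eq_bestValue
      (feas := fun Q => feas (collect (mem l w).item Q)) (by simpa [collect] using h₀)
      (fun Q => f (collect (mem l w).item Q)) Finset.univ K)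
    rw [← bestValue_collect]
    exact ⟨this.1.2.2, this.2⟩
  choose S hS hSout using hout
  have hon : ∀ l, (windowGreedy n m score K).resultOn f feas l =
      (PMF.uniformOfFintype (Fin n → Fin m)).bind fun X => PMF.pure (S l (windowSizes X)) := by
    intro l
    unfold StreamAlg.resultOn
    have : (windowGreedy n m score K).init =
      (PMF.uniformOfFintype (Fin n → Fin m)).map windowSizes := rfl
    rw [this, PMF.bind_map]
    congr 1
    funext X
    simp only [Function.comp, windowGreedy_run, PMF.pure_bind]
    exact hSout l (windowSizes X)
  constructor
  · intro R hR
    unfold StreamAlg.result at hR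
    simp only [hon, PMF.mem_support_bind_iff, PMF.mem_support_pure_iff] at hR
    obtain ⟨σ, -, X, -, rfl⟩ := hR
    exact (hS _ _).1
  · intro T hT
    have hpure : ∀ R, ∑ b, ((PMF.pure R : PMF (Finset (Fin n))) b).toReal * f b = f R := by
      intro R
      rw [Finset.sum_eq_single R] <;> simp +contextual [PMF.pure_apply]
    unfold StreamAlg.result
    simp_rw [hon]
    rw [PMF.sum_toReal_bind_uniform]
    simp_rw [PMF.sum_toReal_bind_uniform, hpure]
    rw [← Finset.mul_sum, sum_perm_eq_sum_stream fun l w => f (S l w)]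
    have hge : ∀ ρ : Equiv.Perm (Fin n), (m : ℝ) ^ n * (r * f T) ≤
        ∑ X : Fin n → Fin m, f (S (stream (List.ofFn ρ) X) (windowSizes X)) := by
      intro ρ
      have hperm : (List.ofFn ρ).Perm (List.finRange n) := by
        rw [List.ofFn_eq_map]
        exact (List.perm_ext_iff_of_nodup ((List.nodup_finRange n).map ρ.injective)
          (List.nodup_finRange n)).2 fun a => by simpa using ⟨ρ.symm a, by simp⟩
      refine (h T hT (List.ofFn ρ) fun a => hperm.mem_iff.2 (List.mem_finRange a)).trans_eq ?_
      refine Finset.sum_congr rfl fun X _ => ?_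
      rw [(hS _ _).2, collect_foldl_stream score hperm f feas X]
    have hsum := Finset.sum_le_sum fun ρ (_ : ρ ∈ (Finset.univ : Finset (Equiv.Perm (Fin n)))) =>
      hge ρ
    rw [Finset.sum_const, nsmul_eq_mul, Finset.card_univ] at hsum
    have hm : (0 : ℝ) < m := by exact_mod_cast Nat.pos_of_neZero m
    have hc : (0 : ℝ) < Fintype.card (Equiv.Perm (Fin n)) := by exact_mod_cast Fintype.card_pos
    rw [inv_mul_eq_div, inv_mul_eq_div, div_div, le_div_iff₀ (by positivity)]
    refine le_trans (le_of_eq ?_) hsum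
    simp
    ring

end RandomOrder

/-! ### Marginal values of monotone submodular functions. -/

section Submodular

variable {α : Type*} [DecidableEq α] {f : Finset α → ℝ}

theorem IsObjective.marginal_le (hf : IsObjective f) {A B : Finset α} (h : A ⊆ B) (e : α) :
    f (insert e B) - f B ≤ f (insert e A) - f A := by
  have h1 := hf.submodular (insert e A) B
  rw [Finset.insert_union, Finset.union_eq_right.2 h] at h1
  have h2 := hf.monotone (Finset.subset_inter (Finset.subset_insert e A) h)
  linarith

theorem IsObjective.le_sum_marginals (hf : IsObjective f) (S T : Finset α) :
    f T - f S ≤ ∑ e ∈ T, (f (insert e S) - f S) := by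
  suffices h : f (T ∪ S) - f S ≤ ∑ e ∈ T, (f (insert e S) - f S) by
    linarith [hf.monotone (Finset.subset_union_left : T ⊆ T ∪ S)]
  induction T using Finset.induction_on with
  | empty => simp
  | insert a T ha ih =>
    rw [Finset.sum_insert ha, Finset.insert_union]
    linarith [hf.marginal_le (Finset.subset_union_right : S ⊆ T ∪ S) a]

/-- Removing sets that cover each item at most `p` times costs at most `p` times the value. -/
theorem IsObjective.sum_removal_le (hf : IsObjective f) (D : Finset α) (U : α → Finset α) (p : ℕ)
    (hU : ∀ u, (D.filter fun e => u ∈ U e).card ≤ p) (S : Finset α) :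
    ∑ e ∈ D, (f S - f (S \ U e)) ≤ p * f S := by
  -- Normalising by `f ∅` lets the induction pay for each new item with its own marginal, charged at
  -- most `p` times.
  suffices h : ∑ e ∈ D, (f S - f (S \ U e)) ≤ p * (f S - f ∅) by
    have := mul_nonneg (Nat.cast_nonneg (α := ℝ) p) (hf.nonneg ∅)
    linarith
  induction S using Finset.induction_on with
  | empty => simp
  | insert u S hu ih =>
    have hstep : ∀ e ∈ D, f (insert u S) - f (insert u S \ U e) ≤
        (f S - f (S \ U e)) + if u ∈ U e then f (insert u S) - f S else 0 := by
      intro e _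
      split_ifs with h
      · rw [Finset.insert_sdiff_of_mem _ h]
        linarith
      · rw [Finset.insert_sdiff_of_notMem _ h]
        linarith [hf.marginal_le (Finset.sdiff_subset : S \ U e ⊆ S) u]
    have hcard : ((D.filter fun e => u ∈ U e).card : ℝ) ≤ p := by exact_mod_cast hU u
    have hmono : 0 ≤ f (insert u S) - f S := sub_nonneg.2 (hf.monotone (Finset.subset_insert u S))
    calc _ ≤ ∑ e ∈ D, ((f S - f (S \ U e)) + if u ∈ U e then f (insert u S) - f S else 0) :=
          Finset.sum_le_sum hstep
      _ = ∑ e ∈ D, (f S - f (S \ U e)) +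
          (D.filter fun e => u ∈ U e).card * (f (insert u S) - f S) := by
          rw [Finset.sum_add_distrib, ← Finset.sum_filter, Finset.sum_const, nsmul_eq_mul]
      _ ≤ p * (f S - f ∅) + p * (f (insert u S) - f S) := by gcongr
      _ = _ := by ring

end Submodular

/-! ### Exchange in matroids and matchoids. -/

section Exchange

variable {α : Type} [DecidableEq α]

/-- Hall's theorem assigns distinct items of `I` to those items of `J \ I` that cannot simply be
added. -/
theorem Matroid.exists_exchange (M : Matroid α) {I J : Finset α} (hI : M.Indep I)
    (hJ : M.Indep J) : ∃ R : α → Finset α, (∀ e ∈ J \ I, M.Indep (insert e (I \ R e) : Finset α)) ∧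
      (∀ u, ((J \ I).filter fun e => u ∈ R e).card ≤ 1) ∧ ∀ e, R e ⊆ I := by
  classical
  let D := (J \ I).filter fun e => ¬ M.Indep (insert e I : Finset α)
  let t : D → Finset α := fun e => I.filter fun u => M.Indep (insert e.1 (I \ {u}) : Finset α)
  have hD : ∀ e : D, e.1 ∈ J ∧ e.1 ∉ I ∧ ¬ M.Indep (insert e.1 I : Finset α) := by
    rintro ⟨e, he⟩
    simpa [D, and_assoc] using he
  have hall : ∀ s : Finset D, s.card ≤ (s.biUnion t).card := by
    intro s
    -- Hall's condition is a rank count: the fundamental circuit of each `e` puts it in the closure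
    -- of its exchange partners, and `s` is independent.
    have hcl : ((s.image Subtype.val : Finset α) : Set α) ⊆
        M.closure ((s.biUnion t : Finset α) : Set α) := by
      intro e he
      obtain ⟨e, hes, rfl⟩ := Finset.mem_image.1 he
      obtain ⟨heJ, heI, hdep⟩ := hD e
      have hecl : e.1 ∈ M.closure (I : Set α) := by
        by_contra hn
        refine hdep ?_
        rw [Finset.coe_insert, hI.insert_indep_iff]
        exact .inl ⟨hJ.subset_ground heJ, hn⟩
      have hC := hI.fundCircuit_isCircuit hecl heI
      refine M.closure_subset_closure ?_
        (hC.mem_closure_sdiff_singleton_of_mem (M.mem_fundCircuit e.1 I))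
      rintro x ⟨hx, hxe⟩
      have hxI : x ∈ I := (M.fundCircuit_subset_insert e.1 I hx).resolve_left hxe
      have := (hI.mem_fundCircuit_iff hecl heI).1 hx
      refine Finset.mem_biUnion.2 ⟨e, hes, Finset.mem_filter.2 ⟨hxI, ?_⟩⟩
      rw [Finset.coe_insert, Finset.coe_sdiff, Finset.coe_singleton]
      rwa [← Set.insert_sdiff_singleton_comm (Ne.symm hxe)] at this
    have hind : M.Indep ((s.image Subtype.val : Finset α) : Set α) := by
      refine hJ.subset fun e he => ?_
      obtain ⟨e, -, rfl⟩ := Finset.mem_image.1 he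
      exact (hD e).1
    have h1 : ((s.image Subtype.val : Finset α) : Set α).encard ≤
        ((s.biUnion t : Finset α) : Set α).encard := by
      rw [← hind.eRk_eq_encard]
      refine (M.eRk_mono hcl).trans ?_
      rw [M.eRk_closure_eq]
      exact M.eRk_le_encard _
    rw [Set.encard_coe_eq_coe_finsetCard, Set.encard_coe_eq_coe_finsetCard,
      Finset.card_image_of_injective _ Subtype.val_injective] at h1
    exact_mod_cast h1
  obtain ⟨g, hg, hgt⟩ := (Finset.all_card_le_biUnion_card_iff_exists_injective t).1 hall
  refine ⟨fun e => if h : e ∈ D then {g ⟨e, h⟩} else ∅, fun e he => ?_, fun u => ?_, fun e => ?_⟩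
  · dsimp only
    split_ifs with h
    · exact (Finset.mem_filter.1 (hgt ⟨e, h⟩)).2
    · rw [Finset.sdiff_empty]
      by_contra hn
      exact h (Finset.mem_filter.2 ⟨he, hn⟩)
  · refine Finset.card_le_one.2 fun a ha b hb => ?_
    obtain ⟨-, ha⟩ := Finset.mem_filter.1 ha
    obtain ⟨-, hb⟩ := Finset.mem_filter.1 hb
    dsimp only at ha hb
    split_ifs at ha hb with h1 h2
    · rw [Finset.mem_singleton] at ha hb
      exact congrArg Subtype.val (hg (ha.symm.trans hb))
    all_goals simp at ha hb
  · dsimp only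
    split_ifs with h
    · exact Finset.singleton_subset_iff.2 (Finset.mem_filter.1 (hgt ⟨e, h⟩)).1
    · exact Finset.empty_subset _

/-- Take the union of the removals in the matroids containing `e`. An item `u` can be removed only
on behalf of the at most `p` matroids containing `u`, once for each. -/
theorem IsMatchoid.exists_exchange {ι : Type} [Fintype ι] {p : ℕ} {N : ι → Matroid α}
    (hN : IsMatchoid p N) {S T : Finset α} (hS : MatchoidFeasible N S) (hT : MatchoidFeasible N T) :
    ∃ U : α → Finset α, (∀ e ∈ T \ S, MatchoidFeasible N (insert e (S \ U e))) ∧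
      ∀ u, ((T \ S).filter fun e => u ∈ U e).card ≤ p := by
  classical
  let part (S : Finset α) (i : ι) : Finset α := S.filter (· ∈ (N i).E)
  have hpart : ∀ {S}, MatchoidFeasible N S → ∀ i, (N i).Indep (part S i : Finset α) := by
    intro S hS i
    convert! hS i using 1
    ext x
    simp [part]
  choose R hR1 hR2 hR3 using fun i => (N i).exists_exchange (hpart hS i) (hpart hT i)
  have hmem : ∀ {e i}, e ∈ T \ S → e ∈ (N i).E → e ∈ part T i \ part S i := by
    intro e i he hi
    simp only [Finset.mem_sdiff, part, Finset.mem_filter] at he ⊢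
    tauto
  refine ⟨fun e => (Finset.univ.filter fun i => e ∈ (N i).E).biUnion fun i => R i e,
    fun e he i => ?_, fun u => ?_⟩
  · by_cases hei : e ∈ (N i).E
    · refine (hR1 i e (hmem he hei)).subset ?_
      rintro x ⟨hx, hxi⟩
      simp only [Finset.coe_insert, Finset.coe_sdiff, Set.mem_insert_iff, Set.mem_sdiff,
        Finset.mem_coe, Finset.mem_biUnion, Finset.mem_filter, Finset.mem_univ, true_and,
        not_exists, not_and, part] at hx ⊢
      exact hx.imp_right fun h => ⟨⟨h.1, hxi⟩, h.2 i hei⟩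
    · refine (hS i).subset ?_
      rintro x ⟨hx, hxi⟩
      rw [Finset.mem_coe, Finset.mem_insert, Finset.mem_sdiff] at hx
      rcases hx with rfl | hx
      · exact absurd hxi hei
      · exact ⟨hx.1, hxi⟩
  · have hsub : ((T \ S).filter fun e =>
        u ∈ (Finset.univ.filter fun i => e ∈ (N i).E).biUnion fun i => R i e) ⊆
        (Finset.univ.filter fun i => u ∈ (N i).E).biUnion fun i =>
          (part T i \ part S i).filter fun e => u ∈ R i e := by
      intro e he
      obtain ⟨he, hu⟩ := Finset.mem_filter.1 he
      obtain ⟨i, hi, hui⟩ := Finset.mem_biUnion.1 hu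
      refine Finset.mem_biUnion.2 ⟨i, ?_, Finset.mem_filter.2
        ⟨hmem he (Finset.mem_filter.1 hi).2, hui⟩⟩
      exact Finset.mem_filter.2 ⟨Finset.mem_univ _, (Finset.mem_filter.1 (hR3 i e hui)).2⟩
    refine (Finset.card_le_card hsub).trans
      ((Finset.card_biUnion_le_card_mul _ _ 1 fun i _ => hR2 i u).trans ?_)
    have := hN u
    have hc : ({i | u ∈ (N i).E} : Set ι) =
        ((Finset.univ.filter fun i => u ∈ (N i).E : Finset ι) : Set ι) := by ext; simp
    rw [hc, Set.encard_coe_eq_coe_finsetCard] at this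
    simpa using this

/-- Exchange each item of `T` into an optimal `S` inside `H`: insertions gain at least f(T) - f(S),
removals cost at most p f(S). -/
theorem IsMatchoid.le_sum_bestValue_insert {ι : Type} [Fintype ι] {p k : ℕ} {N : ι → Matroid α}
    (hN : IsMatchoid p N) {f : Finset α → ℝ} (hf : IsObjective f)
    (hk : ∀ S, MatchoidFeasible N S → S.card ≤ k) {T : Finset α} (hT : MatchoidFeasible N T)
    (H : Finset α) :
    f T - (p + 1) * bestValue f (MatchoidFeasible N) H k ≤
      ∑ e ∈ T, (bestValue f (MatchoidFeasible N) (insert e H) k -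
        bestValue f (MatchoidFeasible N) H k) := by
  have h₀ : MatchoidFeasible N ∅ := fun i => by simp
  obtain ⟨S, ⟨hSH, -, hS⟩, hV⟩ := exists_eq_bestValue h₀ f H k
  obtain ⟨U, hU1, hU2⟩ := hN.exists_exchange hS hT
  rw [← hV]
  have hmem : ∀ e ∈ T \ S, (f (insert e S) - f S) - (f S - f (S \ U e)) ≤
      bestValue f (MatchoidFeasible N) (insert e H) k - f S := by
    intro e he
    have h1 := le_bestValue (value := f) (P := insert e H) (Q := insert e (S \ U e))
      (Finset.insert_subset_insert e (Finset.sdiff_subset.trans hSH)) (hk _ (hU1 e he)) (hU1 e he)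
    linarith [hf.marginal_le (Finset.sdiff_subset : S \ U e ⊆ S) e]
  have hrest : ∑ e ∈ T \ S, (bestValue f (MatchoidFeasible N) (insert e H) k - f S) ≤
      ∑ e ∈ T, (bestValue f (MatchoidFeasible N) (insert e H) k - f S) := by
    refine Finset.sum_le_sum_of_subset_of_nonneg Finset.sdiff_subset fun e _ _ => ?_
    rw [hV, sub_nonneg]
    exact bestValue_mono h₀ (Finset.subset_insert e H) le_rfl
  have hgain : ∑ e ∈ T, (f (insert e S) - f S) = ∑ e ∈ T \ S, (f (insert e S) - f S) := by
    refine (Finset.sum_subset Finset.sdiff_subset fun e he he' => ?_).symm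
    have : e ∈ S := by simpa [he] using he'
    rw [Finset.insert_eq_of_mem this, sub_self]
  have hsum := Finset.sum_le_sum hmem
  rw [Finset.sum_sub_distrib] at hsum
  linarith [hf.le_sum_marginals S T, hf.sum_removal_le (T \ S) U p hU2 S]

end Exchange

/-! ### The recurrence for matchoids. -/

section Matchoid

theorem exp_neg_mul_one_sub_le (x : ℝ) {δ : ℝ} (h0 : 0 ≤ δ) (h1 : δ ≤ 1) :
    Real.exp (-x * (1 - δ)) ≤ (1 - δ) * Real.exp (-x) + δ := by
  have := convexOn_exp.2 (Set.mem_univ (-x)) (Set.mem_univ 0) (sub_nonneg.2 h1) h0 (by ring)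
  simp only [smul_eq_mul, mul_zero, add_zero, Real.exp_zero, mul_one] at this
  rwa [mul_comm (-x)]

theorem one_sub_pow_window_le {m : ℕ} (hm : 0 < m) {x δ : ℝ} (h0 : 0 ≤ δ) (h1 : δ ≤ 1)
    (hle : x * (1 / m * (1 - δ)) ≤ 1) :
    (1 - x * (1 / m * (1 - δ))) ^ m ≤ 1 / Real.exp x + δ := by
  have hm' : (m : ℝ) ≠ 0 := by positivity
  calc _ ≤ Real.exp (-(x * (1 / m * (1 - δ)))) ^ m := by
        refine pow_le_pow_left₀ (by linarith) ?_ m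
        linarith [Real.add_one_le_exp (-(x * (1 / m * (1 - δ))))]
    _ = Real.exp (-x * (1 - δ)) := by
        rw [← Real.exp_nat_mul]
        congr 1
        field_simp
    _ ≤ (1 - δ) * Real.exp (-x) + δ := exp_neg_mul_one_sub_le x h0 h1
    _ ≤ 1 / Real.exp x + δ := by
        rw [Real.exp_neg, one_div]
        have : 0 ≤ (Real.exp x)⁻¹ := by positivity
        nlinarith

theorem windowGreedy_achieves_matchoid {n m k p q : ℕ} [NeZero m] {ε : ℝ} (hkm : k ≤ m)
    (hε : (k : ℝ) / m ≤ ε) {f : Finset (Fin n) → ℝ} (hf : IsObjective f)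
    {N : Fin q → Matroid (Fin n)} (hN : IsMatchoid p N)
    (hk : ∀ S, MatchoidFeasible N S → S.card ≤ k) :
    (windowGreedy n m (fun _ v => v k) k).Achieves
      (1 / ((p : ℝ) + 1) * (1 - 1 / Real.exp ((p : ℝ) + 1) - ε)) f (MatchoidFeasible N) := by
  have h₀ : MatchoidFeasible N ∅ := fun i => by simp
  refine windowGreedy_achieves h₀ _ _ _ fun T hT L hL => ?_
  have hm : 0 < m := Nat.pos_of_neZero m
  have hm' : (0 : ℝ) < m := by exact_mod_cast hm
  set Ψ := potential (fun _ v => v k) f (MatchoidFeasible N) with hΨ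
  have hΨmono : ∀ j, Monotone (Ψ j) := fun j A B h => bestValue_mono h₀ h le_rfl
  have hδ0 : 0 ≤ (k : ℝ) / m := by positivity
  have hδ1 : (k : ℝ) / m ≤ 1 := by
    rw [div_le_one hm']
    exact_mod_cast hkm
  set κ : ℝ := 1 / m * (1 - k / m) with hκ
  have hκ0 : 0 ≤ κ := mul_nonneg (by positivity) (by linarith)
  have hp : (0 : ℝ) < p + 1 := by positivity
  -- Truncation keeps the contraction factor nonnegative when `p` is large compared with `m`; if it
  -- is active, the factor is 0.
  set lam : ℝ := min κ (1 / (p + 1)) with hlam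
  have hlam0 : 0 ≤ lam := le_min hκ0 (by positivity)
  have hlam1 : (p + 1) * lam ≤ 1 := by
    have := mul_le_mul_of_nonneg_left (min_le_right κ (1 / ((p : ℝ) + 1))) hp.le
    rwa [mul_one_div_cancel hp.ne'] at this
  let v (j : ℕ) : ℝ := ∑ X : Fin n → Fin m, bestValue f (MatchoidFeasible N)
    (kept Ψ (window L X) j) k
  have hcard : ∀ c : ℝ, ∑ _X : Fin n → Fin m, c = (m : ℝ) ^ n * c := by
    intro c
    simp
  have hstep : ∀ j < m, v j + lam * ((m : ℝ) ^ n * f T - (p + 1) * v j) ≤ v (j + 1) := by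
    intro j hj
    refine le_trans ?_ (sum_kept_succ_ge ⟨j, hj⟩ (hΨmono j) L hL T (hk T hT) hkm)
    rw [← hcard, Finset.mul_sum, ← Finset.sum_sub_distrib, Finset.mul_sum,
      ← Finset.sum_add_distrib]
    refine Finset.sum_le_sum fun X _ => add_le_add le_rfl ?_
    have h1 := hN.le_sum_bestValue_insert hf hk hT (kept Ψ (window L X) j)
    refine (mul_le_mul_of_nonneg_left h1 hlam0).trans
      (mul_le_mul_of_nonneg_right (min_le_left _ _) ?_)
    exact Finset.sum_nonneg fun e _ => sub_nonneg.2 (hΨmono j (Finset.subset_insert _ _))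
  have hdef : ∀ j ≤ m, (m : ℝ) ^ n * f T - (p + 1) * v j ≤
      (1 - (p + 1) * lam) ^ j * ((m : ℝ) ^ n * f T) := by
    intro j hj
    induction j with
    | zero =>
      have : 0 ≤ v 0 := Finset.sum_nonneg fun X _ => bestValue_nonneg hf.nonneg
      have := mul_nonneg hp.le this
      simpa using this
    | succ j ih =>
      have h1 := hstep j hj
      have h2 := mul_le_mul_of_nonneg_left (ih (by omega)) (sub_nonneg.2 hlam1)
      have h3 := mul_le_mul_of_nonneg_left h1 hp.le
      rw [pow_succ']
      linarith
  have hpow : (1 - (p + 1) * lam) ^ m ≤ 1 / Real.exp ((p : ℝ) + 1) + ε := by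
    rcases le_total κ (1 / ((p : ℝ) + 1)) with h | h
    · have hl : lam = κ := min_eq_left h
      rw [hl] at hlam1 ⊢
      linarith [one_sub_pow_window_le hm hδ0 hδ1 hlam1]
    · have hl : lam = 1 / ((p : ℝ) + 1) := min_eq_right h
      rw [hl, mul_one_div_cancel hp.ne', sub_self, zero_pow hm.ne']
      have : 0 ≤ 1 / Real.exp ((p : ℝ) + 1) := by positivity
      linarith
  have hfT : 0 ≤ (m : ℝ) ^ n * f T := mul_nonneg (by positivity) (hf.nonneg T)
  have h1 := hdef m le_rfl
  have h2 := mul_le_mul_of_nonneg_right hpow hfT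
  have h3 : (1 - 1 / Real.exp ((p : ℝ) + 1) - ε) * ((m : ℝ) ^ n * f T) ≤ (p + 1) * v m := by
    linarith
  calc _ = (1 - 1 / Real.exp ((p : ℝ) + 1) - ε) * ((m : ℝ) ^ n * f T) / (p + 1) := by ring
    _ ≤ v m := by rwa [div_le_iff₀' hp]

end Matchoid

/-! ### Level sequences and the cardinality constraint. -/

section Cardinality

/-- The expected effect of one window on the sequence of optimal values: with probability `q` an
optimal item arrives, and the level increases while the gap to the optimum shrinks by `s`. -/
def levelShift (q s : ℝ) : (ℕ → ℝ) →ₗ[ℝ] (ℕ → ℝ) where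
  toFun v ℓ := (1 - q) * v ℓ + q * (1 - s) * v (ℓ - 1)
  map_add' v w := by
    funext ℓ
    simp only [Pi.add_apply]
    ring
  map_smul' c v := by
    funext ℓ
    simp only [Pi.smul_apply, smul_eq_mul, RingHom.id_apply]
    ring

/-- The part of the optimum that is gained at a level of at least `1`. -/
def levelGain (κ : ℝ) (ℓ : ℕ) : ℝ := if ℓ = 0 then 0 else κ

/-- The shift never looks at higher levels, so a comparison up to level `L` suffices; the one-window
bound is available only up to `k`. -/
theorem levelShift_pow_le {q s : ℝ} (hq0 : 0 ≤ q) (hq1 : q ≤ 1) (hs : s ≤ 1) (r : ℕ) {L : ℕ}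
    {v w : ℕ → ℝ} (h : ∀ ℓ ≤ L, v ℓ ≤ w ℓ) :
    ∀ ℓ ≤ L, (levelShift q s ^ r) v ℓ ≤ (levelShift q s ^ r) w ℓ := by
  induction r generalizing v w with
  | zero => exact h
  | succ r ih =>
    rw [pow_succ, Module.End.mul_apply, Module.End.mul_apply]
    refine ih fun ℓ hℓ => ?_
    have h1 := mul_le_mul_of_nonneg_left (h ℓ hℓ) (sub_nonneg.2 hq1)
    have h2 := mul_le_mul_of_nonneg_left (h (ℓ - 1) (by omega)) (mul_nonneg hq0 (sub_nonneg.2 hs))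
    exact add_le_add h1 h2

theorem levelShift_pow_mono {q s : ℝ} (hq0 : 0 ≤ q) (hq1 : q ≤ 1) (hs : s ≤ 1) (r : ℕ) :
    Monotone (levelShift q s ^ r) :=
  fun _ _ h ℓ => levelShift_pow_le hq0 hq1 hs r (L := ℓ) (fun ℓ' _ => h ℓ') ℓ le_rfl

/-- A lower bound for the fraction of the optimum that is gained in `r` windows at level `ℓ`. -/
theorem sum_levelShift_pow_ge {k : ℕ} (hk : 1 ≤ k) {q D : ℝ} (hq0 : 0 ≤ q) (hq1 : q ≤ 1)
    (hD : 0 < D) (r ℓ : ℕ) :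
    1 - (1 - q / k) ^ r - 1 / k * (((ℓ - r * q) ^ 2 + r * q) / (2 * D) + D / 2) ≤
      ∑ i ∈ Finset.range r, (levelShift q (1 / k) ^ i) (levelGain (q / k)) ℓ := by
  have hk' : (1 : ℝ) ≤ k := by exact_mod_cast hk
  have hk0 : (0 : ℝ) < k := by linarith
  have hs : 1 / (k : ℝ) ≤ 1 := by rw [div_le_one hk0]; exact hk'
  have hqk : 0 ≤ q / k := by positivity
  have hqk1 : q / k ≤ 1 := (div_le_one hk0).2 (by linarith)
  -- The error term majorises (1/k) E|ℓ - Bin(r, q)|, by |x| ≤ x²/(2D) + D/2 and a variance of at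
  -- most rq.
  have hterm : ∀ i, 0 ≤ (levelShift q (1 / k) ^ i) (levelGain (q / k)) := by
    intro i
    have h := levelShift_pow_mono hq0 hq1 hs i
      (show (0 : ℕ → ℝ) ≤ levelGain (q / k) from fun ℓ => by
        unfold levelGain
        split_ifs
        · exact le_rfl
        · exact hqk)
    rwa [map_zero] at h
  induction r generalizing ℓ with
  | zero =>
    simp only [pow_zero, Finset.range_zero, Finset.sum_empty, sub_self, zero_sub]
    have : (0 : ℝ) ≤ 1 / k * (((ℓ - (0 : ℕ) * q) ^ 2 + (0 : ℕ) * q) / (2 * D) + D / 2) := by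
      push_cast
      positivity
    linarith
  | succ r ih =>
    rcases Nat.eq_zero_or_pos ℓ with rfl | hℓ
    · refine le_trans ?_ (Finset.sum_nonneg fun i _ => hterm i 0)
      set x : ℝ := ((r + 1 : ℕ) : ℝ) * q with hx
      have hx0 : 0 ≤ x := by positivity
      -- At level 0 the claimed bound must be nonpositive: Bernoulli's inequality, then the same
      -- quadratic estimate.
      have h1 : 1 - (1 - q / k) ^ (r + 1) ≤ x / k := by
        have := one_add_mul_le_pow (show (-2 : ℝ) ≤ -(q / k) by linarith) (r + 1)
        have e : x / k = ((r + 1 : ℕ) : ℝ) * (q / k) := by rw [hx]; ring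
        rw [e]
        rw [← sub_eq_add_neg] at this
        linarith
      have h2 : x ≤ (x ^ 2 + x) / (2 * D) + D / 2 := by
        have e : (x ^ 2 + x) / (2 * D) + D / 2 - x = ((x - D) ^ 2 + x) / (2 * D) := by
          field_simp
          ring
        have : 0 ≤ ((x - D) ^ 2 + x) / (2 * D) := by positivity
        linarith
      have h3 : x / k ≤ 1 / k * ((((0 : ℕ) - x) ^ 2 + x) / (2 * D) + D / 2) := by
        rw [div_eq_mul_one_div x, mul_comm x]
        refine mul_le_mul_of_nonneg_left ?_ (by positivity)
        simpa using h2
      linarith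
    · have hrec : ∑ i ∈ Finset.range (r + 1), (levelShift q (1 / k) ^ i) (levelGain (q / k)) =
          levelShift q (1 / k)
            (∑ i ∈ Finset.range r, (levelShift q (1 / k) ^ i) (levelGain (q / k))) +
              levelGain (q / k) := by
        rw [Finset.sum_range_succ', map_sum]
        simp [pow_succ']
      have happ : ∀ (r ℓ : ℕ), ∑ i ∈ Finset.range r, (levelShift q (1 / k) ^ i)
          (levelGain (q / k)) ℓ = (∑ i ∈ Finset.range r, (levelShift q (1 / k) ^ i)
            (levelGain (q / k))) ℓ := fun r ℓ => by rw [Finset.sum_apply]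
      rw [happ, hrec]
      simp only [happ] at ih
      set s := ∑ i ∈ Finset.range r, (levelShift q (1 / k) ^ i) (levelGain (q / k))
      change _ ≤ (1 - q) * s ℓ + q * (1 - 1 / k) * s (ℓ - 1) + levelGain (q / k) ℓ
      rw [levelGain, if_neg hℓ.ne']
      have h1 := mul_le_mul_of_nonneg_left (ih ℓ) (sub_nonneg.2 hq1)
      have h2 := mul_le_mul_of_nonneg_left (ih (ℓ - 1)) (mul_nonneg hq0 (sub_nonneg.2 hs))
      have hc : ((ℓ - 1 : ℕ) : ℝ) = ℓ - 1 := by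
        rw [Nat.cast_sub hℓ]
        simp
      rw [hc] at h2
      refine le_trans ?_ (add_le_add_left (add_le_add h1 h2) _)
      rw [pow_succ]
      set P := (1 - q / k) ^ r
      set x : ℝ := ℓ - r * q with hx
      have hx1 : (ℓ : ℝ) - 1 - r * q = x - 1 := by rw [hx]; ring
      have hx2 : (ℓ : ℝ) - ((r + 1 : ℕ) : ℝ) * q = x - q := by rw [hx]; push_cast; ring
      rw [hx1, hx2]
      push_cast
      set u : ℝ := 1 / k with hu
      have hqu : q / k = q * u := by rw [hu]; ring
      rw [hqu]
      have hu0 : 0 ≤ u := by positivity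
      set d : ℝ := 1 / (2 * D) with hd
      have hd0 : 0 < d := by positivity
      have hdiv : ∀ y : ℝ, y / (2 * D) = y * d := fun y => by rw [hd]; ring
      simp only [hdiv]
      have hrq : 0 ≤ r * q := by positivity
      -- The slack in the recursion: using q instead of q(1 - q) as the variance of a step, and
      -- dropping the discount on the error term.
      have hA : 0 ≤ u * (q ^ 2 * d) := by positivity
      have hB : 0 ≤ u * (q * u * (((x - 1) ^ 2 + r * q) * d + D / 2)) := by positivity
      linarith only [hA, hB]

/-- Add each item of `T` to an optimal set of level `ℓ`, which leaves room at level `ℓ + 1`. The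
term with factor `k` accounts for the change of reference level. -/
theorem le_sum_bestValue_insert_card {α : Type*} [DecidableEq α] {k : ℕ} {f : Finset α → ℝ}
    (hf : IsObjective f) {T : Finset α} (hT : T.card ≤ k) (H : Finset α) {ℓ : ℕ} (hℓ : ℓ < k) :
    f T - bestValue f (fun S => S.card ≤ k) H ℓ +
      k * (bestValue f (fun S => S.card ≤ k) H ℓ - bestValue f (fun S => S.card ≤ k) H (ℓ + 1)) ≤
      ∑ e ∈ T, (bestValue f (fun S => S.card ≤ k) (insert e H) (ℓ + 1) -
        bestValue f (fun S => S.card ≤ k) H (ℓ + 1)) := by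
  have h₀ : (∅ : Finset α).card ≤ k := by simp
  obtain ⟨S, ⟨hSH, hSℓ, hS⟩, hV⟩ := exists_eq_bestValue (feas := fun S => S.card ≤ k) h₀ f H ℓ
  rw [← hV]
  set V := bestValue f (fun S => S.card ≤ k) H (ℓ + 1)
  have hle : f S ≤ V := hV.le.trans (bestValue_mono h₀ subset_rfl (Nat.le_succ ℓ))
  have hmem : ∀ e ∈ T, (f (insert e S) - f S) + (f S - V) ≤
      bestValue f (fun S => S.card ≤ k) (insert e H) (ℓ + 1) - V := by
    intro e _
    have hc := Finset.card_insert_le e S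
    have := le_bestValue (value := f) (feas := fun S => S.card ≤ k) (ℓ := ℓ + 1)
      (Finset.insert_subset_insert e hSH) (by omega) (show (insert e S).card ≤ k by omega)
    linarith
  have hsum := Finset.sum_le_sum hmem
  rw [Finset.sum_add_distrib, Finset.sum_const, nsmul_eq_mul] at hsum
  have hT' : (T.card : ℝ) ≤ k := by exact_mod_cast hT
  have := mul_le_mul_of_nonpos_right hT' (sub_nonpos.2 hle)
  linarith [hf.le_sum_marginals S T]

theorem windowGreedy_achieves_card {n m k : ℕ} [NeZero m] {ε : ℝ} (hε0 : 0 < ε)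
    (hk : 16 / ε ^ 2 ≤ (k : ℝ)) (hε : (k : ℝ) / m ≤ ε / 4) (hkm : k ≤ m)
    {f : Finset (Fin n) → ℝ} (hf : IsObjective f) :
    (windowGreedy n m (fun j v =>
      (levelShift (k * (1 / m * (1 - k / m))) (1 / k) ^ (m - j - 1)) v k) k).Achieves
        (1 - 1 / Real.exp 1 - ε) f (fun S => S.card ≤ k) := by
  have h₀ : (∅ : Finset (Fin n)).card ≤ k := by simp
  refine windowGreedy_achieves h₀ _ _ _ fun T hT L hL => ?_
  have hm : 0 < m := Nat.pos_of_neZero m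
  have hm' : (0 : ℝ) < m := by exact_mod_cast hm
  have hk0 : (0 : ℝ) < k := lt_of_lt_of_le (by positivity) hk
  have hk1 : 1 ≤ k := by exact_mod_cast hk0
  have hs : 1 / (k : ℝ) ≤ 1 := by
    rw [div_le_one hk0]
    exact_mod_cast hk1
  have hδ0 : 0 ≤ (k : ℝ) / m := by positivity
  have hδ1 : (k : ℝ) / m ≤ 1 := by
    rw [div_le_one hm']
    exact_mod_cast hkm
  set δ : ℝ := k / m with hδ
  set κ : ℝ := 1 / m * (1 - δ) with hκ
  set q : ℝ := k * κ with hq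
  have hκ0 : 0 ≤ κ := mul_nonneg (by positivity) (by linarith)
  have hq0 : 0 ≤ q := mul_nonneg hk0.le hκ0
  have hq_eq : q = δ * (1 - δ) := by rw [hq, hκ, hδ]; ring
  have hq1 : q ≤ 1 := by nlinarith
  have hqk : q / k = κ := by rw [hq]; field_simp
  set A := levelShift q (1 / k) with hA
  set Ψ := potential (fun j v => (A ^ (m - j - 1)) v k) f (fun S => S.card ≤ k) with hΨ
  set V : Finset (Fin n) → ℕ → ℝ := bestValue f fun S => S.card ≤ k with hV
  have hVmono : ∀ {H H' : Finset (Fin n)}, H ⊆ H' → V H ≤ V H' :=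
    fun h ℓ => bestValue_mono h₀ h le_rfl
  have hΨmono : ∀ j, Monotone (Ψ j) := fun j H H' h =>
    levelShift_pow_mono hq0 hq1 hs _ (hVmono h) k
  have hVnonneg : ∀ H ℓ, 0 ≤ V H ℓ := fun H ℓ => bestValue_nonneg hf.nonneg
  have hwindow : ∀ H, ∀ ℓ ≤ k, (A (V H) + f T • levelGain κ) ℓ ≤
      (V H + κ • ∑ e ∈ T, (V (insert e H) - V H)) ℓ := by
    intro H ℓ hℓ
    simp only [Pi.add_apply, Pi.smul_apply, Finset.sum_apply, Pi.sub_apply, smul_eq_mul]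
    change (1 - q) * V H ℓ + q * (1 - 1 / k) * V H (ℓ - 1) + f T * levelGain κ ℓ ≤ _
    have hqs : q * (1 - 1 / k) = q - κ := by rw [← hqk]; ring
    rw [hqs]
    rcases ℓ with _ | ℓ
    · have h1 : 0 ≤ ∑ e ∈ T, (V (insert e H) 0 - V H 0) :=
        Finset.sum_nonneg fun e _ => sub_nonneg.2 (hVmono (Finset.subset_insert e H) 0)
      have h2 := mul_nonneg hκ0 h1
      have h3 := mul_nonneg hκ0 (hVnonneg H 0)
      simp only [levelGain, if_true]
      linarith
    · have h1 := mul_le_mul_of_nonneg_left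
        (le_sum_bestValue_insert_card hf hT H (Nat.lt_of_succ_le hℓ)) hκ0
      simp only [levelGain, Nat.add_one_ne_zero, if_false, Nat.add_sub_cancel]
      refine le_trans (le_of_eq ?_) (add_le_add_right h1 _)
      rw [hq]
      ring
  have hpoint : ∀ r H, (A ^ (r + 1)) (V H) k + f T * (A ^ r) (levelGain κ) k ≤
      (A ^ r) (V H) k + κ * ∑ e ∈ T, ((A ^ r) (V (insert e H)) k - (A ^ r) (V H) k) := by
    intro r H
    have := levelShift_pow_le hq0 hq1 hs r (hwindow H) k le_rfl
    rw [← hA] at this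
    simp only [map_add, map_smul, map_sum, map_sub, Pi.add_apply, Pi.smul_apply, smul_eq_mul,
      Finset.sum_apply, Pi.sub_apply] at this
    rwa [pow_succ, Module.End.mul_apply]
  have hcard : ∀ c : ℝ, ∑ _X : Fin n → Fin m, c = (m : ℝ) ^ n * c := by
    intro c
    simp
  -- The exponent counts the windows still to come; the score of window `j` has one shift fewer, the
  -- window itself accounting for it.
  let u (j : ℕ) : ℝ := ∑ X : Fin n → Fin m, (A ^ (m - j)) (V (kept Ψ (window L X) j)) k
  have hstep : ∀ j < m, u j + (m : ℝ) ^ n * f T * (A ^ (m - 1 - j)) (levelGain κ) k ≤ u (j + 1) := by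
    intro j hj
    have h1 := sum_kept_succ_ge ⟨j, hj⟩ (hΨmono j) L hL T hT hkm
    have e1 : m - j = m - j - 1 + 1 := by omega
    have e2 : m - (j + 1) = m - j - 1 := by omega
    have e3 : m - 1 - j = m - j - 1 := by omega
    refine le_trans ?_ (h1.trans_eq (by simp only [u, e2]; rfl))
    rw [mul_assoc, ← hcard, ← Finset.sum_add_distrib]
    refine Finset.sum_le_sum fun X _ => ?_
    have h2 := hpoint (m - j - 1) (kept Ψ (window L X) j)
    rw [← e1] at h2
    rw [e3]
    exact h2
  have htel : ∀ j ≤ m, (m : ℝ) ^ n * f T *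
      ∑ i ∈ Finset.range j, (A ^ (m - 1 - i)) (levelGain κ) k ≤ u j := by
    intro j hj
    induction j with
    | zero =>
      rw [Finset.sum_range_zero, mul_zero]
      refine Finset.sum_nonneg fun X _ => ?_
      have h := levelShift_pow_mono hq0 hq1 hs (m - 0)
        (show (0 : ℕ → ℝ) ≤ V (kept Ψ (window L X) 0) from hVnonneg _) k
      rwa [map_zero] at h
    | succ j ih =>
      rw [Finset.sum_range_succ, mul_add]
      linarith [ih (by omega), hstep j hj]
  have hend := htel m le_rfl
  rw [Finset.sum_range_reflect fun i => (A ^ i) (levelGain κ) k] at hend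
  -- This `D` costs ε/4; the bias k - mq = kδ and the variance then cost at most ε/16 each, by δ ≤
  -- ε/4 and k ≥ 16/ε².
  have hgain := sum_levelShift_pow_ge hk1 hq0 hq1 (show 0 < (k : ℝ) * ε / 2 by positivity) m k
  rw [← hA, hqk] at hgain
  have hpow : (1 - κ) ^ m ≤ 1 / Real.exp 1 + δ := by
    have hκ1 : 1 * κ ≤ 1 := by
      rw [one_mul, hκ]
      have : 1 / (m : ℝ) ≤ 1 := by
        rw [div_le_one hm']
        exact_mod_cast hm
      nlinarith [show 0 < 1 / (m : ℝ) by positivity]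
    have h := one_sub_pow_window_le hm hδ0 hδ1 hκ1
    rw [one_mul] at h
    exact h
  have hmq : m * q = k * (1 - δ) := by rw [hq, hκ]; field_simp
  have herr : 1 / (k : ℝ) * ((((k : ℝ) - m * q) ^ 2 + m * q) / (2 * (k * ε / 2)) + k * ε / 2 / 2) ≤
      3 * ε / 8 := by
    rw [hmq]
    have e : 1 / (k : ℝ) * ((((k : ℝ) - k * (1 - δ)) ^ 2 + k * (1 - δ)) / (2 * (k * ε / 2)) +
        k * ε / 2 / 2) = δ ^ 2 / ε + (1 - δ) / (k * ε) + ε / 4 := by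
      field_simp
      ring
    rw [e]
    have h1 : δ ^ 2 / ε ≤ ε / 16 := by
      rw [div_le_iff₀ hε0]
      nlinarith
    have h2 : (1 - δ) / (k * ε) ≤ ε / 16 := by
      rw [div_le_iff₀ (by positivity)]
      rw [div_le_iff₀ (by positivity)] at hk
      nlinarith
    linarith
  have hfT : 0 ≤ (m : ℝ) ^ n * f T := mul_nonneg (by positivity) (hf.nonneg T)
  have hfinal : 1 - 1 / Real.exp 1 - ε ≤ ∑ i ∈ Finset.range m, (A ^ i) (levelGain κ) k := by
    linarith
  calc _ = (m : ℝ) ^ n * f T * (1 - 1 / Real.exp 1 - ε) := by ring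
    _ ≤ u m := (mul_le_mul_of_nonneg_left hfinal hfT).trans hend
    _ = _ := by simp [u, hV]

end Cardinality

/-! ### Choice of the number of windows and degenerate cases. -/

section Main

/-- The algorithm without memory. -/
noncomputable def emptyAlg (n : ℕ) : StreamAlg n 0 where
  init := PMF.pure fun i => i.elim0
  step _ := PMF.pure (fun i => i.elim0, fun i => i.elim0)
  output _ := PMF.pure ∅

theorem emptyAlg_achieves {n : ℕ} {r : ℝ} {f : Finset (Fin n) → ℝ} {feas : Finset (Fin n) → Prop}
    (h₀ : feas ∅) (h : ∀ T, feas T → r * f T ≤ f ∅) : (emptyAlg n).Achieves r f feas := by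
  have hres : (emptyAlg n).result f feas = PMF.pure ∅ := by
    unfold StreamAlg.result StreamAlg.resultOn
    have : ∀ μ : StreamMemory (Fin n) n 0, ((emptyAlg n).output
        (StreamView.of f feas μ.word μ.item)).map (collect μ.item) = PMF.pure ∅ := by
      intro μ
      unfold emptyAlg
      rw [PMF.pure_map]
      simp [collect]
    simp only [this, PMF.bind_const]
  unfold StreamAlg.Achieves
  rw [hres]
  refine ⟨fun S hS => ?_, fun T hT => (h T hT).trans_eq ?_⟩
  · rw [PMF.mem_support_pure_iff] at hS
    exact hS ▸ h₀
  · rw [Finset.sum_eq_single ∅] <;> simp +contextual [PMF.pure_apply]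

theorem exists_alg_matchoid {ε : ℝ} (hε : 0 < ε) (p k n : ℕ) :
    ∃ M : ℕ, (M : ℝ) ≤ 2 * (k / ε) ∧ ∃ A : StreamAlg n M, ∀ f : Finset (Fin n) → ℝ,
      IsObjective f → ∀ (q : ℕ) (N : Fin q → Matroid (Fin n)), IsMatchoid p N →
        (∀ S, MatchoidFeasible N S → S.card ≤ k) →
          A.Achieves (1 / ((p : ℝ) + 1) * (1 - 1 / Real.exp ((p : ℝ) + 1) - ε)) f
            (MatchoidFeasible N) := by
  have hp : (0 : ℝ) ≤ 1 / ((p : ℝ) + 1) := by positivity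
  have hexp : (0 : ℝ) ≤ 1 / Real.exp ((p : ℝ) + 1) := by positivity
  rcases Nat.eq_zero_or_pos k with rfl | hk
  -- For k = 0 no memory is allowed, and only the empty set is feasible.
  · refine ⟨0, by simp, emptyAlg n, fun f hf q N _ hN => emptyAlg_achieves (fun i => by simp)
      fun T hT => ?_⟩
    obtain rfl : T = ∅ := by simpa using hN T hT
    refine mul_le_of_le_one_left (hf.nonneg _) ?_
    have hp1 : 1 / ((p : ℝ) + 1) ≤ 1 := by
      rw [div_le_one (by positivity)]
      linarith [Nat.cast_nonneg (α := ℝ) p]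
    refine (mul_le_mul_of_nonneg_left (show _ ≤ (1 : ℝ) by linarith) hp).trans (by simpa using hp1)
  rcases le_or_gt 1 ε with h1 | h1
  · refine ⟨0, by simp; positivity, emptyAlg n, fun f hf q N _ _ => emptyAlg_achieves
      (fun i => by simp) fun T _ => ?_⟩
    refine le_trans (mul_nonpos_of_nonpos_of_nonneg ?_ (hf.nonneg T)) (hf.nonneg ∅)
    exact mul_nonpos_of_nonneg_of_nonpos hp (by linarith)
  have hk1 : (1 : ℝ) ≤ k := by exact_mod_cast hk
  have hkε : (k : ℝ) ≤ k / ε := by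
    rw [le_div_iff₀ hε]
    nlinarith
  have hceil := Nat.le_ceil ((k : ℝ) / ε)
  have hm : 0 < ⌈(k : ℝ) / ε⌉₊ := Nat.ceil_pos.2 (by positivity)
  have : NeZero ⌈(k : ℝ) / ε⌉₊ := ⟨hm.ne'⟩
  refine ⟨⌈(k : ℝ) / ε⌉₊, ?_, windowGreedy n _ (fun _ v => v k) k, fun f hf q N hN hcard =>
    windowGreedy_achieves_matchoid ?_ ?_ hf hN hcard⟩
  · linarith [Nat.ceil_lt_add_one (show 0 ≤ (k : ℝ) / ε by positivity)]
  · exact_mod_cast hkε.trans hceil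
  · rw [div_le_iff₀ (by exact_mod_cast hm)]
    rwa [div_le_iff₀' hε] at hceil

/-- Matchoid feasibility ignores items outside the ground set; enlarging it to everything makes them
loops, as independence in `N` requires. -/
theorem matchoidFeasible_restrict_univ {α : Type} (N : Matroid α) :
    MatchoidFeasible (fun _ : Fin 1 => N.restrict Set.univ) =
      fun S : Finset α => N.Indep (S : Set α) := by
  funext S
  simp [MatchoidFeasible]

theorem isMatchoid_fin_one {α : Type} (N : Fin 1 → Matroid α) : IsMatchoid 1 N := fun _ =>
  Set.encard_le_one_iff.2 fun _ _ _ _ => Subsingleton.elim _ _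

theorem exists_alg_card {ε : ℝ} (hε : 0 < ε) {k : ℕ} (n : ℕ) (hk : 16 / ε ^ 2 ≤ (k : ℝ)) :
    ∃ M : ℕ, (M : ℝ) ≤ 16 * (k / ε ^ 2) ∧ ∃ A : StreamAlg n M, ∀ f : Finset (Fin n) → ℝ,
      IsObjective f → A.Achieves (1 - 1 / Real.exp 1 - ε) f (fun S => S.card ≤ k) := by
  have hexp : (0 : ℝ) ≤ 1 / Real.exp 1 := by positivity
  rcases le_or_gt 1 ε with h1 | h1
  · refine ⟨0, by simp; positivity, emptyAlg n, fun f hf => emptyAlg_achieves (by simp)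
      fun T _ => ?_⟩
    exact le_trans (mul_nonpos_of_nonpos_of_nonneg (by linarith) (hf.nonneg T)) (hf.nonneg ∅)
  have hk0 : (0 : ℝ) < k := lt_of_lt_of_le (by positivity) hk
  have hk1 : (1 : ℝ) ≤ k := by
    have : 0 < k := by exact_mod_cast hk0
    exact_mod_cast this
  have hkε : (k : ℝ) ≤ k / ε := by
    rw [le_div_iff₀ hε]
    nlinarith
  have hkε2 : (k : ℝ) / ε ≤ k / ε ^ 2 := by
    refine div_le_div_of_nonneg_left hk0.le (by positivity) ?_
    nlinarith
  have hceil := Nat.le_ceil (4 * ((k : ℝ) / ε))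
  have hm : 0 < ⌈4 * ((k : ℝ) / ε)⌉₊ := Nat.ceil_pos.2 (by positivity)
  have : NeZero ⌈4 * ((k : ℝ) / ε)⌉₊ := ⟨hm.ne'⟩
  refine ⟨⌈4 * ((k : ℝ) / ε)⌉₊, ?_, windowGreedy n _ _ k, fun f hf =>
    windowGreedy_achieves_card hε hk ?_ ?_ hf⟩
  · linarith [Nat.ceil_lt_add_one (show 0 ≤ 4 * ((k : ℝ) / ε) by positivity)]
  · rw [div_le_iff₀ (by exact_mod_cast hm)]
    have e : (k : ℝ) = ε / 4 * (4 * (k / ε)) := by field_simp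
    calc (k : ℝ) = ε / 4 * (4 * (k / ε)) := e
      _ ≤ _ := by gcongr
  · have : (k : ℝ) ≤ (⌈4 * ((k : ℝ) / ε)⌉₊ : ℝ) := by linarith
    exact_mod_cast this

end Main


theorem mainTheorem4 :
    -- cardinality constraint `k`
    (∃ C : ℝ, 0 < C ∧ ∃ c : ℕ, ∀ ε : ℝ, 0 < ε → ∀ k n : ℕ, C / ε ^ 2 ≤ (k : ℝ) →
      ∃ M : ℕ, (M : ℝ) ≤ C * (k / ε ^ 2) * Real.log (2 + 1 / ε) ^ c ∧
        ∃ A : StreamAlg n M, ∀ f : Finset (Fin n) → ℝ, IsObjective f →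
          A.Achieves (1 - 1 / Real.exp 1 - ε) f (fun S => S.card ≤ k)) ∧
    -- a matroid of rank `k`
    (∃ C : ℝ, 0 < C ∧ ∀ ε : ℝ, 0 < ε → ∀ k n : ℕ,
      ∃ M : ℕ, (M : ℝ) ≤ C * (k / ε) ∧
        ∃ A : StreamAlg n M, ∀ f : Finset (Fin n) → ℝ, IsObjective f →
          ∀ N : Matroid (Fin n), N.eRank = (k : ℕ∞) →
            A.Achieves (1 / 2 * (1 - 1 / Real.exp 2 - ε)) f
              (fun S => N.Indep (S : Set (Fin n)))) ∧
    -- a `p`-matchoid whose largest feasible sets have `k` items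
    (∃ C : ℝ, 0 < C ∧ ∀ ε : ℝ, 0 < ε → ∀ p k n : ℕ,
      ∃ M : ℕ, (M : ℝ) ≤ C * (k / ε) ∧
        ∃ A : StreamAlg n M, ∀ f : Finset (Fin n) → ℝ, IsObjective f →
          ∀ (q : ℕ) (N : Fin q → Matroid (Fin n)), IsMatchoid p N →
            IsGreatest {j : ℕ | ∃ S : Finset (Fin n), MatchoidFeasible N S ∧ S.card = j} k →
              A.Achieves (1 / ((p : ℝ) + 1) * (1 - 1 / Real.exp ((p : ℝ) + 1) - ε)) f
                (MatchoidFeasible N)) := by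
  -- The exponent 0 is enough: no logarithmic factor is needed.
  refine ⟨⟨16, by norm_num, 0, fun ε hε k n hk => ?_⟩, ⟨2, by norm_num, fun ε hε k n => ?_⟩,
    ⟨2, by norm_num, fun ε hε p k n => ?_⟩⟩
  · obtain ⟨M, hM, A, hA⟩ := exists_alg_card hε n hk
    exact ⟨M, by simpa using hM, A, hA⟩
  · obtain ⟨M, hM, A, hA⟩ := exists_alg_matchoid hε 1 k n
    refine ⟨M, hM, A, fun f hf N hN => ?_⟩
    have h := hA f hf 1 (fun _ => N.restrict Set.univ) (isMatchoid_fin_one _)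
    rw [matchoidFeasible_restrict_univ] at h
    have h' := h fun S hS => by
      have := Matroid.Indep.encard_le_eRank hS
      rw [hN, Set.encard_coe_eq_coe_finsetCard] at this
      exact_mod_cast this
    have e : ((1 : ℕ) : ℝ) + 1 = 2 := by norm_num
    rwa [e] at h'
  · obtain ⟨M, hM, A, hA⟩ := exists_alg_matchoid hε p k n
    exact ⟨M, hM, A, fun f hf q N hN hk => hA f hf q N hN fun S hS => hk.2 ⟨S, hS, rfl⟩⟩
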